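/- **Setting.** Fix an integer $k\ge 2$ and strictly increasing sequences of natural numbers $(m_j)_{j\ge1}$, $(n_j)_{j\ge1}$ with $m_1\ge4$, $m_{j+1}\ge m_j^2$, $n_1\ge m_1^2$ and $n_{j+1}\ge(16n_j)^{\log_2 m_{j+1}}$, and a strictly increasing sequence $(N_n)$ of natural numbers. *The set $\Gamma^{\max}$.* Define disjoint sets $\Delta_n$ ($n\ge1$) recursively, with $\Gamma^{\max}_n=\bigcup_{q\le n}\Delta_q$, $\Gamma^{\max}=\bigcup_n\Delta_n$; an element of $\Delta_n$ has rank $n$. Put $\Delta_1=\{0,1,\dots,k-1\}$ (these points have no weight and no age). For $0\le p<n$ let $B_{p,n}$ be the set of all $b^*=\sum_{\eta\in\Gamma^{\max}_n\setminus\Gamma^{\max}_p}a_\eta e_\eta^*$ with $\sum|a_\eta|\le1$ and each $a_\eta$ rational with denominator dividing $N_n!$. For $n\ge1$, $\Delta_{n+1}$ consists of * the tuples $(n+1,p,m_j^{-1},b^*)$ with $1\le j\le n+1$, $0\le p<n$, $b^*\in B_{p,n}$, which have weight $m_j^{-1}$ and age $1$; * the tuples $(n+1,\xi,m_j^{-1},b^*)$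 with $\xi\in\Delta_p$, $1\le p\le n-1$, $1\le j\le p$, $\operatorname{weight}\xi=m_j^{-1}$, $\operatorname{age}\xi<n_j$, $b^*\in B_{p,n}$, which have weight $m_j^{-1}$ and age $1+\operatorname{age}\xi$. *The functionals $d_\gamma^*$.* By recursion on the rank there are unique finitely supported $c_\gamma^*$, $d_\gamma^*=e_\gamma^*-c_\gamma^*$ and linear projections $P^*_{(0,p]}$ on the finitely supported functionals such that $P^*_{(0,p]}d_\gamma^*=d_\gamma^*$ if $\operatorname{rank}\gamma\le p$ and $P^*_{(0,p]}d_\gamma^*=0$ otherwise, where $c_\gamma^*=0$ for $\gamma\in\Delta_1$, $c_\gamma^*=\beta(I-P^*_{(0,p]})b^*$ for $\gamma=(n+1,p,\beta,b^*)$, and $c_\gamma^*=e_\xi^*+\beta(I-P^*_{(0,\operatorname{rank}\xi]})b^*$ for $\gamma=(n+1,\xi,\beta,b^*)$. Write $P^*_{(p,\infty)}=I-P^*_{(0,p]}$. *The coding map $G$ and $R^*$.* Define $G:\Gamma^{\max}\to\Gamma^{\max}\cup\{\text{undefined}\}$ by recursion on the rank, where throughout $R^*$ is the linear map with $R^*e_\gamma^*=e_{G(\gamma)}^*$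 if $G(\gamma)$ is defined and $R^*e_\gamma^*=0$ otherwise: $G(0)$ is undefined and $G(j)=j-1$ for $1\le j\le k-1$; for $\gamma=(n+1,p,\beta,b^*)$, $G(\gamma)$ is undefined if $P^*_{(p,\infty)}R^*b^*=0$ and $G(\gamma)=(n+1,p,\beta,R^*b^*)$ otherwise; for $\gamma=(n+1,\xi,\beta,b^*)$, $G(\gamma)=(n+1,G(\xi),\beta,R^*b^*)$ if $G(\xi)$ is defined, while if $G(\xi)$ is undefined then $G(\gamma)$ is undefined if $P^*_{(\operatorname{rank}\xi,\infty)}R^*b^*=0$ and $G(\gamma)=(n+1,\operatorname{rank}\xi,\beta,R^*b^*)$ otherwise. Extend $R^*$ to a bounded linear operator on $\ell_1(\Gamma^{\max})$. *The set $\Gamma$.* Let $\sigma:\Gamma^{\max}\to\mathbb N$ be injective with $\sigma(\gamma)>\operatorname{rank}\gamma$ for all $\gamma$ and $\sigma(\gamma)>\sigma(\xi)$ whenever $\operatorname{rank}\gamma>\operatorname{rank}\xi$, and put $\Sigma(\gamma)=\{\sigma(\gamma)\}\cup\{\sigma(\delta):\delta\in\Gamma^{\max},\ G^j(\delta)=\gamma\text{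 for some }1\le j\le k-1\}$. Define $\Delta'_n\subseteq\Delta_n$ recursively, with $\Gamma_n=\bigcup_{q\le n}\Delta_q'$ and $\Gamma=\bigcup_n\Delta'_n$: $\Delta_1'=\Delta_1$, and for $n\ge1$ the set $\Delta_{n+1}'$ consists of * $(n+1,p,m_{2j}^{-1},b^*)$ with $j\ge1$, $2j\le n+1$, $0\le p<n$, $b^*\in B_{p,n}$ supported in $\Gamma_n$; * $(n+1,\xi,m_{2j}^{-1},b^*)$ with $\xi\in\Delta'_p$, $1\le p\le n-1$, $j\ge1$, $2j\le p$, $\operatorname{weight}\xi=m_{2j}^{-1}$, $\operatorname{age}\xi<n_{2j}$, $b^*\in B_{p,n}$ supported in $\Gamma_n$; * $(n+1,p,m_{2j-1}^{-1},b^*)$ with $j\ge1$, $2j-1\le n+1$, $0\le p<n$, and $b^*=0$ or $b^*=e_\eta^*$ with $\eta\in\Gamma_n\setminus\Gamma_p$ and $\operatorname{weight}\eta=m_{4i}^{-1}<n_{2j-1}^{-2}$ for some $i\ge1$; * $(n+1,\xi,m_{2j-1}^{-1},b^*)$ with $\xi\in\Delta'_p$, $1\le p\le n-1$, $j\ge1$,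 $2j-1\le p$, $\operatorname{weight}\xi=m_{2j-1}^{-1}$, $\operatorname{age}\xi<n_{2j-1}$, and $b^*=0$ or $b^*=e_\eta^*$ with $\eta\in\Gamma_n\setminus\Gamma_p$ and $\operatorname{weight}\eta=m_{4i}^{-1}<n_{2j-1}^{-2}$ for some $i\in\Sigma(\xi)$. For $\gamma\in\Gamma$ the functional $d_\gamma^*$ is supported in $\Gamma$. Let $\mathfrak X_k=X(\Gamma)\subseteq\ell_\infty(\Gamma)=\ell_1(\Gamma)^*$ be the closed linear span of the vectors $d_\gamma$ ($\gamma\in\Gamma$) biorthogonal to $(d_\gamma^*)_{\gamma\in\Gamma}$. **Proposition 2.17.** The set $\Gamma$ is invariant under $G$: if $\gamma\in\Gamma$ and $G(\gamma)$ is defined, then $G(\gamma)\in\Gamma$. Hence $G$ restricts to a map $F:\Gamma\to\Gamma\cup\{\text{undefined}\}$, and $R^*$ restricts to a bounded linear operator $S^*:\ell_1(\Gamma)\to\ell_1(\Gamma)$ of norm $1$ satisfying, for every $\gamma\in\Gamma$, $$S^*e_\gamma^*=\begin{cases}0&\text{if }F(\gamma)\text{ is undefined},\\ e_{F(\gamma)}^*&\text{otherwise.}\end{cases}$$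 Moreover, the dual operator of $S^*$ restricts to a bounded linear operator $S:\mathfrak X_k\to\mathfrak X_k$ of norm at most $1$, with $S^j\ne0$ for $1\le j\le k-1$ and $S^k=0$. -/

import Mathlib

open scoped ENNReal Nat

noncomputable section

namespace BourgainDelbaen

/-! ## Tuples -/

/-- The possible last coordinates of an element of given rank, over a set `V` of elements of
smaller rank: `base i` is the point `i` of the initial set `{0, …, k - 1}`, `one p β b` stands for
the tuple `(rank, p, β, b)` and `two ξ β b` stands for `(rank, ξ, β, b)`.  A finitely supported
function `b : V →₀ ℝ` stands for the functional `∑ b(η) e_η^*`. -/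
inductive Tup (k : ℕ) (V : Type) : Type
  | base (i : Fin k) : Tup k V
  | one (p : ℕ) (β : ℝ) (b : V →₀ ℝ) : Tup k V
  | two (ξ : V) (β : ℝ) (b : V →₀ ℝ) : Tup k V

/-- `Lev k q` is the collection of all (unrestricted) tuples of rank at most `q`. -/
@[reducible] def Lev (k : ℕ) : ℕ → Type
  | 0 => Empty
  | q + 1 => Lev k q ⊕ Tup k (Lev k q)

/-- All (unrestricted) tuples; `⟨q, t⟩` has rank `q + 1`. -/
def Univ (k : ℕ) : Type := Σ q : ℕ, Tup k (Lev k q)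

/-- The tuples of rank at most `q` as tuples. -/
def inc {k : ℕ} : (q : ℕ) → Lev k q → Univ k
  | 0, v => Empty.elim v
  | q + 1, Sum.inl v => inc q v
  | q + 1, Sum.inr t => ⟨q, t⟩

/-- The rank (the first coordinate of a tuple). -/
def rank {k : ℕ} (γ : Univ k) : ℕ := γ.1 + 1

/-- The weight; the points of `Δ_1` have no weight. -/
def weight {k : ℕ} : Univ k → Option ℝ
  | ⟨_, Tup.base _⟩ => none
  | ⟨_, Tup.one _ β _⟩ => some β
  | ⟨_, Tup.two _ β _⟩ => some β

/-- The age on tuples of rank at most `q` (with the value `0` on the points of `Δ_1`). -/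
def ageLev {k : ℕ} : (q : ℕ) → Lev k q → ℕ
  | 0, v => Empty.elim v
  | q + 1, Sum.inl v => ageLev q v
  | _ + 1, Sum.inr (Tup.base _) => 0
  | _ + 1, Sum.inr (Tup.one _ _ _) => 1
  | q + 1, Sum.inr (Tup.two ξ _ _) => 1 + ageLev q ξ

/-- The age of a tuple. -/
def age {k : ℕ} (γ : Univ k) : ℕ := ageLev (γ.1 + 1) (Sum.inr γ.2)

/-! ## The functionals `c^*`, `d^*`, the projections `P^*` and the maps `G`, `R^*` -/

/-- The BD-functional `c_γ^*` of `γ = ⟨q, t⟩`, as a functional on elements of rank at most `q`; the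
argument `P p` is the projection `P^*_{(0,p]}` there. -/
def cOf {k : ℕ} (q : ℕ) (P : ℕ → (Lev k q →₀ ℝ) →ₗ[ℝ] (Lev k q →₀ ℝ)) :
    Tup k (Lev k q) → (Lev k q →₀ ℝ)
  | Tup.base _ => 0
  | Tup.one p β b => β • (b - P p b)
  | Tup.two ξ β b => Finsupp.single ξ 1 + β • (b - P (rank (inc q ξ)) b)

/-- The projection `P^*_{(0,p]}` on the finitely supported functionals on elements of rank at most
`q`.  It is determined by `P^*_{(0,p]} d_γ^* = d_γ^*` if `rank γ ≤ p` and `P^*_{(0,p]} d_γ^* = 0`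
otherwise, where `e_γ^* = c_γ^* + d_γ^*`; so `P^*_{(0,p]} e_γ^*` is `e_γ^*` if `rank γ ≤ p`, and
`P^*_{(0,p]} c_γ^*` otherwise (see `proj_dLev` below). -/
def proj {k : ℕ} : (q : ℕ) → ℕ → (Lev k q →₀ ℝ) →ₗ[ℝ] (Lev k q →₀ ℝ)
  | 0, _ => 0
  | q + 1, p => Finsupp.linearCombination ℝ fun w : Lev k q ⊕ Tup k (Lev k q) =>
      match w with
      | Sum.inl v => Finsupp.mapDomain Sum.inl (proj q p (Finsupp.single v 1))
      | Sum.inr t =>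
          open Classical in
          if q + 1 ≤ p then Finsupp.single (Sum.inr t) 1
          else Finsupp.mapDomain Sum.inl (proj q p (cOf q (proj q) t))

/-- `c_γ^*` for `γ = ⟨q, t⟩`. -/
def cStar {k : ℕ} (γ : Univ k) : Univ k →₀ ℝ :=
  Finsupp.mapDomain (inc γ.1) (cOf γ.1 (proj γ.1) γ.2)

/-- `d_γ^* = e_γ^* - c_γ^*`. -/
def dStar {k : ℕ} (γ : Univ k) : Univ k →₀ ℝ := Finsupp.single γ 1 - cStar γ

/-- The linear map on finitely supported functionals with `e_v^* ↦ e_{g v}^*` if `g v` is defined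
and `e_v^* ↦ 0` otherwise. -/
def pushFin {V : Type} (g : V → Option V) : (V →₀ ℝ) →ₗ[ℝ] (V →₀ ℝ) :=
  Finsupp.linearCombination ℝ fun v => (g v).elim 0 fun w => Finsupp.single w 1

/-- The recursion step in the definition of the coding map: `g` is the coding map on the elements
of rank at most `q`, and the result is the coding map on the elements of rank `q + 1`. -/
def codeStep {k : ℕ} (q : ℕ) (g : Lev k q → Option (Lev k q)) :
    Tup k (Lev k q) → Option (Tup k (Lev k q))
  | Tup.base i => if i.1 = 0 then none else some (Tup.base ⟨i.1 - 1, by omega⟩)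
  | Tup.one p β b =>
      open Classical in
      if pushFin g b - proj q p (pushFin g b) = 0 then none
      else some (Tup.one p β (pushFin g b))
  | Tup.two ξ β b =>
      match g ξ with
      | some ξ' => some (Tup.two ξ' β (pushFin g b))
      | none =>
          open Classical in
          if pushFin g b - proj q (rank (inc q ξ)) (pushFin g b) = 0 then none
          else some (Tup.one (rank (inc q ξ)) β (pushFin g b))

/-- The coding map on elements of rank at most `q`. -/
def codeLev {k : ℕ} : (q : ℕ) → Lev k q → Option (Lev k q)
  | 0, _ => none
  | q + 1, Sum.inl v => (codeLev q v).map Sum.inl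
  | q + 1, Sum.inr t => (codeStep q (codeLev q) t).map Sum.inr

/-- The coding map `G`, with `none` for `undefined`. -/
def code {k : ℕ} (γ : Univ k) : Option (Univ k) :=
  (codeStep γ.1 (codeLev γ.1) γ.2).map fun t => ⟨γ.1, t⟩

/-- The iterates of `G`. -/
def codeIter {k : ℕ} (j : ℕ) (γ : Univ k) : Option (Univ k) :=
  (fun o : Option (Univ k) => o.bind code)^[j] (some γ)

/-! ## The index sets -/

/-- The assumptions on the two sequences, indexed by `j ≥ 1`. -/
structure Growth (m n : ℕ → ℕ) : Prop where
  m_strict : ∀ j, 1 ≤ j → m j < m (j + 1)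
  n_strict : ∀ j, 1 ≤ j → n j < n (j + 1)
  m_one : 4 ≤ m 1
  m_succ : ∀ j, 1 ≤ j → m j ^ 2 ≤ m (j + 1)
  n_one : m 1 ^ 2 ≤ n 1
  n_succ : ∀ j, 1 ≤ j → (16 * (n j : ℝ)) ^ Real.logb 2 (m (j + 1)) ≤ (n (j + 1) : ℝ)

/-- `∑ |b(v)| ≤ 1`, and all coefficients are rational with denominator dividing `D!`. -/
def IsCoef {V : Type} (D : ℕ) (b : V →₀ ℝ) : Prop :=
  (b.sum fun _ a => |a|) ≤ 1 ∧ ∀ v, ∃ z : ℤ, b v = (z : ℝ) / (D ! : ℝ)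

/-- Membership in `Γ^max`.  In `one` and `two` the conditions on `b` say `b ∈ B_{p,q}`, where
`p = rank ξ` in `two`. -/
inductive IsMax (k : ℕ) (m n N : ℕ → ℕ) : Univ k → Prop
  | base (i : Fin k) : IsMax k m n N ⟨0, Tup.base i⟩
  | one (q p j : ℕ) (b : Lev k q →₀ ℝ) (hj : 1 ≤ j) (hjq : j ≤ q + 1) (hp : p < q)
      (hmem : ∀ v ∈ b.support, IsMax k m n N (inc q v))
      (hrank : ∀ v ∈ b.support, p < rank (inc q v))
      (hcoef : IsCoef (N q) b) :
      IsMax k m n N ⟨q, Tup.one p (m j : ℝ)⁻¹ b⟩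
  | two (q j : ℕ) (ξ : Lev k q) (b : Lev k q →₀ ℝ) (hj : 1 ≤ j) (hjξ : j ≤ rank (inc q ξ))
      (hξq : rank (inc q ξ) < q) (hξ : IsMax k m n N (inc q ξ))
      (hweight : weight (inc q ξ) = some (m j : ℝ)⁻¹) (hage : age (inc q ξ) < n j)
      (hmem : ∀ v ∈ b.support, IsMax k m n N (inc q v))
      (hrank : ∀ v ∈ b.support, rank (inc q ξ) < rank (inc q v))
      (hcoef : IsCoef (N q) b) :
      IsMax k m n N ⟨q, Tup.two ξ (m j : ℝ)⁻¹ b⟩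

/-- The index set `Γ^max`. -/
abbrev GammaMax (k : ℕ) (m n N : ℕ → ℕ) : Type := {γ : Univ k // IsMax k m n N γ}

/-- The requirements on the function `σ`. -/
structure IsSigma {k : ℕ} {m n N : ℕ → ℕ} (σ : GammaMax k m n N → ℕ) : Prop where
  injective : Function.Injective σ
  rank_lt : ∀ γ, rank γ.1 < σ γ
  lt_of_rank_lt : ∀ γ ξ : GammaMax k m n N, rank ξ.1 < rank γ.1 → σ ξ < σ γ

/-- The set `Σ(γ) = {σ(γ)} ∪ {σ(δ) : G^j(δ) = γ for some 1 ≤ j ≤ k - 1}`. -/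
def sigmaSet {k : ℕ} {m n N : ℕ → ℕ} (σ : GammaMax k m n N → ℕ) (γ : Univ k) : Set ℕ :=
  {s | ∃ δ : GammaMax k m n N, ∃ j ≤ k - 1, codeIter j δ.1 = some γ ∧ σ δ = s}

/-- Membership in `Γ`. -/
inductive IsGam {k : ℕ} {m n N : ℕ → ℕ} (σ : GammaMax k m n N → ℕ) : Univ k → Prop
  | base (i : Fin k) : IsGam σ ⟨0, Tup.base i⟩
  | evenOne (q p j : ℕ) (b : Lev k q →₀ ℝ) (hj : 1 ≤ j) (hjq : 2 * j ≤ q + 1) (hp : p < q)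
      (hmem : ∀ v ∈ b.support, IsGam σ (inc q v))
      (hrank : ∀ v ∈ b.support, p < rank (inc q v))
      (hcoef : IsCoef (N q) b) :
      IsGam σ ⟨q, Tup.one p (m (2 * j) : ℝ)⁻¹ b⟩
  | evenTwo (q j : ℕ) (ξ : Lev k q) (b : Lev k q →₀ ℝ) (hj : 1 ≤ j)
      (hjξ : 2 * j ≤ rank (inc q ξ)) (hξq : rank (inc q ξ) < q) (hξ : IsGam σ (inc q ξ))
      (hweight : weight (inc q ξ) = some (m (2 * j) : ℝ)⁻¹) (hage : age (inc q ξ) < n (2 * j))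
      (hmem : ∀ v ∈ b.support, IsGam σ (inc q v))
      (hrank : ∀ v ∈ b.support, rank (inc q ξ) < rank (inc q v))
      (hcoef : IsCoef (N q) b) :
      IsGam σ ⟨q, Tup.two ξ (m (2 * j) : ℝ)⁻¹ b⟩
  | oddOneZero (q p j : ℕ) (hj : 1 ≤ j) (hjq : 2 * j - 1 ≤ q + 1) (hp : p < q) :
      IsGam σ ⟨q, Tup.one p (m (2 * j - 1) : ℝ)⁻¹ 0⟩
  | oddOne (q p j i : ℕ) (η : Lev k q) (hj : 1 ≤ j) (hjq : 2 * j - 1 ≤ q + 1) (hp : p < q)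
      (hη : IsGam σ (inc q η)) (hrank : p < rank (inc q η)) (hi : 1 ≤ i)
      (hweight : weight (inc q η) = some (m (4 * i) : ℝ)⁻¹)
      (hlt : (m (4 * i) : ℝ)⁻¹ < ((n (2 * j - 1) : ℝ) ^ 2)⁻¹) :
      IsGam σ ⟨q, Tup.one p (m (2 * j - 1) : ℝ)⁻¹ (Finsupp.single η 1)⟩
  | oddTwoZero (q j : ℕ) (ξ : Lev k q) (hj : 1 ≤ j)
      (hjξ : 2 * j - 1 ≤ rank (inc q ξ)) (hξq : rank (inc q ξ) < q) (hξ : IsGam σ (inc q ξ))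
      (hweight : weight (inc q ξ) = some (m (2 * j - 1) : ℝ)⁻¹)
      (hage : age (inc q ξ) < n (2 * j - 1)) :
      IsGam σ ⟨q, Tup.two ξ (m (2 * j - 1) : ℝ)⁻¹ 0⟩
  | oddTwo (q j i : ℕ) (ξ η : Lev k q) (hj : 1 ≤ j)
      (hjξ : 2 * j - 1 ≤ rank (inc q ξ)) (hξq : rank (inc q ξ) < q) (hξ : IsGam σ (inc q ξ))
      (hweight : weight (inc q ξ) = some (m (2 * j - 1) : ℝ)⁻¹)
      (hage : age (inc q ξ) < n (2 * j - 1))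
      (hη : IsGam σ (inc q η)) (hrank : rank (inc q ξ) < rank (inc q η))
      (hi : i ∈ sigmaSet σ (inc q ξ))
      (hweightη : weight (inc q η) = some (m (4 * i) : ℝ)⁻¹)
      (hlt : (m (4 * i) : ℝ)⁻¹ < ((n (2 * j - 1) : ℝ) ^ 2)⁻¹) :
      IsGam σ ⟨q, Tup.two ξ (m (2 * j - 1) : ℝ)⁻¹ (Finsupp.single η 1)⟩

/-- The index set `Γ`. -/
abbrev Gamma {k : ℕ} {m n N : ℕ → ℕ} (σ : GammaMax k m n N → ℕ) : Type :=
  {γ : Univ k // IsGam σ γ}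

/-! ## Facts that the definitions below need -/

theorem proj_of_le {k : ℕ} (q p : ℕ) (h : q ≤ p) : (proj q p : (Lev k q →₀ ℝ) →ₗ[ℝ] _) = .id := by
  induction q with
  | zero =>
    ext v
    exact Empty.elim v
  | succ q ih =>
    refine Finsupp.lhom_ext' fun w => LinearMap.ext_ring ?_
    rcases w with v | t
    · simp [proj, ih (by omega), Finsupp.mapDomain_single]
    · simp [proj, h]

/-- Property (A) of the projections: `P^*_{(0,p]} d_γ^*` is `d_γ^*` or `0`. -/
theorem proj_dLev {k : ℕ} (q p : ℕ) (t : Tup k (Lev k q)) :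
    proj (q + 1) p (Finsupp.single (Sum.inr t) 1 - Finsupp.mapDomain Sum.inl (cOf q (proj q) t))
      = if q + 1 ≤ p then
          Finsupp.single (Sum.inr t) 1 - Finsupp.mapDomain Sum.inl (cOf q (proj q) t)
        else 0 := by
  split_ifs with h
  · rw [proj_of_le _ _ h]; rfl
  · have key : ∀ c : Lev k q →₀ ℝ, proj (q + 1) p (Finsupp.mapDomain Sum.inl c)
        = Finsupp.mapDomain Sum.inl (proj q p c) := by
      intro c
      induction c using Finsupp.induction_linear with
      | zero => simp
      | add f g hf hg => simp only [Finsupp.mapDomain_add, map_add, hf, hg]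
      | single v r =>
        rw [Finsupp.mapDomain_single, ← mul_one r, ← smul_eq_mul, ← Finsupp.smul_single,
          ← Finsupp.smul_single, map_smul, map_smul, Finsupp.mapDomain_smul]
        simp [proj]
    rw [map_sub, key]
    simp [proj, h]

theorem isCoef_zero {V : Type} (D : ℕ) : IsCoef D (0 : V →₀ ℝ) :=
  ⟨by simp, fun _ => ⟨0, by simp⟩⟩

theorem isCoef_single {V : Type} (D : ℕ) (v : V) : IsCoef D (Finsupp.single v (1 : ℝ)) := by
  classical
  have hD : (D ! : ℝ) ≠ 0 := by exact_mod_cast D.factorial_ne_zero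
  refine ⟨by simp, fun w => ?_⟩
  by_cases h : v = w
  · exact ⟨(D ! : ℕ), by simp [h, hD]⟩
  · exact ⟨0, by simp [h]⟩

theorem pushFin_eq {V : Type} (g : V → Option V) (b : V →₀ ℝ) :
    pushFin g b = ∑ v ∈ b.support, b v • (g v).elim 0 fun w => Finsupp.single w (1 : ℝ) := by
  simp [pushFin, Finsupp.linearCombination_apply, Finsupp.sum]

theorem exists_of_mem_support_pushFin {V : Type} {g : V → Option V} {b : V →₀ ℝ} {w : V}
    (h : w ∈ (pushFin g b).support) : ∃ v ∈ b.support, g v = some w := by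
  classical
  by_contra! hc
  rw [Finsupp.mem_support_iff, pushFin_eq, Finsupp.finsetSum_apply] at h
  refine h (Finset.sum_eq_zero fun v hv => ?_)
  rcases hg : g v with _ | u
  · simp
  · have : u ≠ w := fun e => hc v hv (by rw [hg, e])
    simp [this]

theorem sum_abs_add_le {V : Type} (f g : V →₀ ℝ) :
    ((f + g).sum fun _ a => |a|) ≤ (f.sum fun _ a => |a|) + g.sum fun _ a => |a| := by
  classical
  rw [Finsupp.sum_of_support_subset (f + g) Finsupp.support_add _ (by simp),
    Finsupp.sum_of_support_subset f (Finset.subset_union_left (s₂ := g.support)) _ (by simp),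
    Finsupp.sum_of_support_subset g (Finset.subset_union_right (s₁ := f.support)) _ (by simp),
    ← Finset.sum_add_distrib]
  exact Finset.sum_le_sum fun v _ => abs_add_le _ _

theorem isCoef_pushFin {V : Type} {D : ℕ} (g : V → Option V) {b : V →₀ ℝ} (h : IsCoef D b) :
    IsCoef D (pushFin g b) := by
  classical
  refine ⟨le_trans ?_ h.1, fun w => ?_⟩
  · rw [pushFin_eq]
    change _ ≤ ∑ v ∈ b.support, |b v|
    generalize b.support = s
    induction s using Finset.induction_on with
    | empty => simp
    | insert v s hv ih =>
      rw [Finset.sum_insert hv, Finset.sum_insert hv]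
      refine (sum_abs_add_le _ _).trans (add_le_add ?_ ih)
      rcases g v with _ | u
      · simp
      · simp
  · rw [pushFin_eq, Finsupp.finsetSum_apply]
    choose z hz using h.2
    refine ⟨∑ v ∈ b.support, if g v = some w then z v else 0, ?_⟩
    push_cast
    rw [Finset.sum_div]
    refine Finset.sum_congr rfl fun v _ => ?_
    rcases hg : g v with _ | u
    · simp
    · by_cases e : u = w
      · simp [e, ← hz]
      · simp [e]

theorem code_inc {k : ℕ} : ∀ (q : ℕ) (v : Lev k q), code (inc q v) = (codeLev q v).map (inc q)
  | 0, v => Empty.elim v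
  | q + 1, Sum.inl v => by
      simp only [inc, codeLev, code_inc q v, Option.map_map]
      rfl
  | q + 1, Sum.inr t => by
      simp only [inc, codeLev, code, Option.map_map]
      rfl

theorem age_inc {k : ℕ} : ∀ (q : ℕ) (v : Lev k q), age (inc q v) = ageLev q v
  | 0, v => Empty.elim v
  | q + 1, Sum.inl v => by simp only [inc, ageLev, age_inc q v]
  | q + 1, Sum.inr t => rfl

theorem rank_code {k : ℕ} {γ δ : Univ k} (h : code γ = some δ) : rank δ = rank γ := by
  obtain ⟨t, _, rfl⟩ := Option.map_eq_some_iff.1 h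
  rfl

theorem weight_code {k : ℕ} {γ δ : Univ k} (h : code γ = some δ) : weight δ = weight γ := by
  obtain ⟨q, t⟩ := γ
  obtain ⟨t', ht, rfl⟩ := Option.map_eq_some_iff.1 h
  cases t with
  | base i =>
    simp only [codeStep] at ht
    split_ifs at ht
    obtain rfl := Option.some.inj ht
    rfl
  | one p β b =>
    simp only [codeStep] at ht
    split_ifs at ht
    obtain rfl := Option.some.inj ht
    rfl
  | two ξ β b =>
    simp only [codeStep] at ht
    split at ht
    · obtain rfl := Option.some.inj ht
      rfl
    · split_ifs at ht
      obtain rfl := Option.some.inj ht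
      rfl

theorem ageLev_codeLev_le {k : ℕ} : ∀ (q : ℕ) (v w : Lev k q), codeLev q v = some w →
    ageLev q w ≤ ageLev q v
  | 0, v, _, _ => Empty.elim v
  | q + 1, Sum.inl v, w, h => by
      obtain ⟨u, hu, rfl⟩ := Option.map_eq_some_iff.1 h
      exact ageLev_codeLev_le q v u hu
  | q + 1, Sum.inr t, w, h => by
      obtain ⟨t', ht, rfl⟩ := Option.map_eq_some_iff.1 h
      cases t with
      | base i =>
        simp only [codeStep] at ht
        split_ifs at ht
        obtain rfl := Option.some.inj ht
        exact le_rfl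
      | one p β b =>
        simp only [codeStep] at ht
        split_ifs at ht
        obtain rfl := Option.some.inj ht
        exact le_rfl
      | two ξ β b =>
        simp only [codeStep] at ht
        split at ht
        · rename_i ξ' hξ'
          obtain rfl := Option.some.inj ht
          exact Nat.add_le_add_left (ageLev_codeLev_le q ξ ξ' hξ') 1
        · split_ifs at ht
          obtain rfl := Option.some.inj ht
          exact Nat.le_add_right 1 _

theorem IsGam.isMax {k : ℕ} {m n N : ℕ → ℕ} {σ : GammaMax k m n N → ℕ} {γ : Univ k}
    (h : IsGam σ γ) : IsMax k m n N γ := by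
  classical
  induction h with
  | base i => exact .base i
  | evenOne q p j b hj hjq hp _ hrank hcoef ih =>
    exact .one q p (2 * j) b (by omega) hjq hp ih hrank hcoef
  | evenTwo q j ξ b hj hjξ hξq _ hw hage _ hrank hcoef ihξ ih =>
    exact .two q (2 * j) ξ b (by omega) hjξ hξq ihξ hw hage ih hrank hcoef
  | oddOneZero q p j hj hjq hp =>
    exact .one q p (2 * j - 1) 0 (by omega) hjq hp (by simp) (by simp) (isCoef_zero _)
  | oddOne q p j i η hj hjq hp _ hrank _ _ _ ih =>
    refine .one q p (2 * j - 1) _ (by omega) hjq hp (fun v hv => ?_) (fun v hv => ?_)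
      (isCoef_single _ _) <;>
    · obtain rfl := Finset.mem_singleton.1 (Finsupp.support_single_subset hv)
      assumption
  | oddTwoZero q j ξ hj hjξ hξq _ hw hage ihξ =>
    exact .two q (2 * j - 1) ξ 0 (by omega) hjξ hξq ihξ hw hage (by simp) (by simp)
      (isCoef_zero _)
  | oddTwo q j i ξ η hj hjξ hξq _ hw hage _ hrank _ _ _ ihξ ih =>
    refine .two q (2 * j - 1) ξ _ (by omega) hjξ hξq ihξ hw hage (fun v hv => ?_)
      (fun v hv => ?_) (isCoef_single _ _) <;>
    · obtain rfl := Finset.mem_singleton.1 (Finsupp.support_single_subset hv)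
      assumption

/-- `G` maps `Γ^max` into `Γ^max ∪ {undefined}`. -/
theorem IsMax.code {k : ℕ} {m n N : ℕ → ℕ} {γ δ : Univ k} (h : IsMax k m n N γ)
    (hδ : code γ = some δ) : IsMax k m n N δ := by
  have inner : ∀ (q : ℕ) (v w : Lev k q), codeLev q v = some w →
      BourgainDelbaen.code (inc q v) = some (inc q w) := by
    intro q v w hv
    rw [code_inc, hv]
    rfl
  induction h generalizing δ with
  | base i =>
    obtain ⟨t, ht, rfl⟩ := Option.map_eq_some_iff.1 hδ
    simp only [codeStep] at ht
    split_ifs at ht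
    obtain rfl := Option.some.inj ht
    exact .base _
  | one q p j b hj hjq hp _ hrank hcoef ih =>
    obtain ⟨t, ht, rfl⟩ := Option.map_eq_some_iff.1 hδ
    simp only [codeStep] at ht
    split_ifs at ht
    obtain rfl := Option.some.inj ht
    refine .one q p j _ hj hjq hp (fun w hw => ?_) (fun w hw => ?_) (isCoef_pushFin _ hcoef) <;>
      obtain ⟨v, hv, hvw⟩ := exists_of_mem_support_pushFin hw
    · exact ih v hv (inner q v w hvw)
    · rw [rank_code (inner q v w hvw)]
      exact hrank v hv
  | two q j ξ b hj hjξ hξq _ hwt hage _ hrank hcoef ihξ ih =>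
    obtain ⟨t, ht, rfl⟩ := Option.map_eq_some_iff.1 hδ
    simp only [codeStep] at ht
    split at ht
    · rename_i ξ' hξ'
      obtain rfl := Option.some.inj ht
      have hc := inner q ξ ξ' hξ'
      have hr := rank_code hc
      refine .two q j ξ' _ hj (hr ▸ hjξ) (hr ▸ hξq) (ihξ hc) ((weight_code hc).trans hwt) ?_
        (fun w hw => ?_) (fun w hw => ?_) (isCoef_pushFin _ hcoef)
      · refine lt_of_le_of_lt ?_ hage
        rw [age_inc, age_inc]
        exact ageLev_codeLev_le q ξ ξ' hξ'
      · obtain ⟨v, hv, hvw⟩ := exists_of_mem_support_pushFin hw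
        exact ih v hv (inner q v w hvw)
      · obtain ⟨v, hv, hvw⟩ := exists_of_mem_support_pushFin hw
        rw [rank_code (inner q v w hvw), hr]
        exact hrank v hv
    · split_ifs at ht
      obtain rfl := Option.some.inj ht
      refine .one q _ j _ hj (by omega) hξq (fun w hw => ?_) (fun w hw => ?_)
        (isCoef_pushFin _ hcoef) <;>
        obtain ⟨v, hv, hvw⟩ := exists_of_mem_support_pushFin hw
      · exact ih v hv (inner q v w hvw)
      · rw [rank_code (inner q v w hvw)]
        exact hrank v hv

/-! ## The spaces and the operators -/

/-- `ℓ_1(α)`. -/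
abbrev L1 (α : Type) : Type := lp (fun _ : α => ℝ) 1

/-- `ℓ_∞(α)`. -/
abbrev LInf (α : Type) : Type := lp (fun _ : α => ℝ) ∞

/-- The unit vector `e_a^*` of `ℓ_1(α)`. -/
def eStar {α : Type} (a : α) : L1 α :=
  open Classical in lp.single 1 a (1 : ℝ)

/-- The duality between `ℓ_∞(α) = ℓ_1(α)^*` and `ℓ_1(α)`. -/
def pairing {α : Type} (x : LInf α) (y : L1 α) : ℝ := ∑' a, x a * y a

theorem norm_eStar {α : Type} (a : α) : ‖eStar a‖ = 1 := by
  classical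
  exact (lp.norm_single (E := fun _ : α => ℝ) one_pos a (1 : ℝ)).trans norm_one

/-- The vector `e_{f(a)}^*`, or `0` if `f(a)` is undefined. -/
def image {α β : Type} (f : α → Option β) (a : α) : L1 β :=
  match f a with
  | none => 0
  | some b => eStar b

theorem norm_image_le {α β : Type} (f : α → Option β) (a : α) : ‖image f a‖ ≤ 1 := by
  unfold image
  cases f a with
  | none => simp
  | some b => simp [norm_eStar]

theorem summable_coord {α : Type} (x : L1 α) : Summable fun a => ‖x a‖ := by
  simpa using (lp.memℓp x).summable (by simp)

theorem summable_push {α β : Type} (f : α → Option β) (x : L1 α) :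
    Summable fun a => ‖x a • image f a‖ := by
  refine Summable.of_nonneg_of_le (fun _ => norm_nonneg _) (fun a => ?_) (summable_coord x)
  rw [norm_smul]
  exact mul_le_of_le_one_right (norm_nonneg _) (norm_image_le f a)

/-- The bounded linear map `ℓ_1(α) → ℓ_1(β)` with `e_a^* ↦ e_{f(a)}^*` if `f(a)` is defined and
`e_a^* ↦ 0` otherwise. -/
def push {α β : Type} (f : α → Option β) : L1 α →L[ℝ] L1 β :=
  LinearMap.mkContinuous
    { toFun := fun x => ∑' a, x a • image f a
      map_add' := fun x y => by
        rw [← Summable.tsum_add (summable_push f x).of_norm (summable_push f y).of_norm]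
        exact tsum_congr fun a => by rw [lp.coeFn_add, Pi.add_apply, add_smul]
      map_smul' := fun c x => by
        rw [RingHom.id_apply, ← tsum_const_smul'']
        exact tsum_congr fun a => by rw [lp.coeFn_smul, Pi.smul_apply, smul_assoc] }
    1 fun x => by
      have hn : ‖x‖ = ∑' a, ‖x a‖ := by
        simpa using lp.norm_eq_tsum_rpow (p := 1) (by simp) x
      rw [one_mul, hn]
      refine (norm_tsum_le_tsum_norm (summable_push f x)).trans ?_
      refine Summable.tsum_le_tsum (fun a => ?_) (summable_push f x) (summable_coord x)
      rw [norm_smul]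
      exact mul_le_of_le_one_right (norm_nonneg _) (norm_image_le f a)

theorem push_eStar {α β : Type} (f : α → Option β) (a : α) : push f (eStar a) = image f a := by
  classical
  change ∑' a', (eStar a : L1 α) a' • image f a' = _
  rw [tsum_eq_single a]
  · simp [eStar]
  · intro b hb
    simp [eStar, lp.single_apply, hb]

section
variable {k : ℕ} {m n N : ℕ → ℕ}

/-- The coding map `G : Γ^max → Γ^max ∪ {undefined}`. -/
def codeMax (γ : GammaMax k m n N) : Option (GammaMax k m n N) :=
  (code γ.1).pmap Subtype.mk fun _ hδ => γ.2.code hδ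

/-- The operator `R^*` on `ℓ_1(Γ^max)`, with `R^* e_γ^* = e_{G(γ)}^*` or `0`. -/
def rStar (k : ℕ) (m n N : ℕ → ℕ) : L1 (GammaMax k m n N) →L[ℝ] L1 (GammaMax k m n N) :=
  push codeMax

variable (σ : GammaMax k m n N → ℕ)

/-- The inclusion of `Γ` in `Γ^max`. -/
def incl (γ : Gamma σ) : GammaMax k m n N := ⟨γ.1, γ.2.isMax⟩

/-- The inclusion of `ℓ_1(Γ)` in `ℓ_1(Γ^max)`, with `e_γ^* ↦ e_γ^*`. -/
def inclL1 : L1 (Gamma σ) →L[ℝ] L1 (GammaMax k m n N) :=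
  push fun γ => some (incl σ γ)

/-- `d_γ^*` for `γ ∈ Γ`, as an element of `ℓ_1(Γ)` (it is supported in `Γ`). -/
def dStarGam (γ : Gamma σ) : L1 (Gamma σ) :=
  ((dStar γ.1).subtypeDomain (IsGam σ)).sum fun η a => a • eStar η

/-- The closed linear span in `ℓ_∞(Γ)` of the vectors `d_γ`, `γ ∈ Γ`, biorthogonal to the basis
`(d_γ^*)` of `ℓ_1(Γ)`. -/
def xSubmodule : Submodule ℝ (LInf (Gamma σ)) :=
  (Submodule.span ℝ {x : LInf (Gamma σ) | ∃ γ : Gamma σ,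
    pairing x (dStarGam σ γ) = 1 ∧ ∀ θ, θ ≠ γ → pairing x (dStarGam σ θ) = 0}).topologicalClosure

/-- The space `𝔛_k = X(Γ)`, with the norm of `ℓ_∞(Γ)`. -/
def XSpace : Type := xSubmodule σ

instance : NormedAddCommGroup (XSpace σ) := inferInstanceAs (NormedAddCommGroup (xSubmodule σ))

instance : NormedSpace ℝ (XSpace σ) := inferInstanceAs (NormedSpace ℝ (xSubmodule σ))

end

/-- The inclusion of `𝔛_k` in `ℓ_∞(Γ)`. -/
def XSpace.toLInf {k : ℕ} {m n N : ℕ → ℕ} {σ : GammaMax k m n N → ℕ} (x : XSpace σ) :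
    LInf (Gamma σ) := x.1

end BourgainDelbaen

end

/-!
The map `G` is compatible with the whole construction: the condition under which `G(γ)` is
undefined is exactly that `R^* c_γ^* = 0`, so by induction on the rank `R^*` commutes with the
projections `P^*_{(0,p]}` and `R^* d_γ^*` is `d_{G(γ)}^*`, or `0` if `G(γ)` is undefined
(`pushFin_code_projU`, `pushFin_code_dStar`).

*Invariance of `Γ`* (`IsGam.code`).  The one delicate clause of the definition of `Γ` is that of
odd weight and age greater than `1`, where the code `i` of `η` has to stay admissible after `ξ` is
replaced by `G(ξ)`.  This holds because `Σ(ξ) ⊆ Σ(G(ξ))` (`sigmaSet_subset_of_code`), which in turn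
holds because `G^k` is nowhere defined (`iterBind_code_eq_none`): an element `δ` with
`G^j(δ) = ξ` and `G(ξ)` defined has `j + 1 < k`.

*The operators.*  `S^*` is the operator on `ℓ_1(Γ)` induced by the restriction `F` of `G`, and its
dual `pull F` maps `x` to `x ∘ F`, which is visibly a contraction.  It remains to see that
it preserves `𝔛_k`.  The weights are at most `1/4`, hence the projections `P^*_{(0,p]}` have norm at
most `2` (`sumAbs_projU_single_le`), and so the biorthogonal vectors `d_γ` exist in `ℓ_∞(Γ)`
(`dVec`).  An element of `ℓ_∞(Γ)` is determined by its values on the `d_θ^*`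
(`eq_zero_of_pairing_dStarGam`), and comparing these values gives that `d_δ` is mapped to the sum of
the `d_γ` with `F(γ) = δ` (`pull_mem_xSubmodule`), a finite sum because `G` preserves the rank and
there are finitely many elements of each rank (`finite_isMax_rank`).  Finally `S^k = 0` because
`F^k` is nowhere defined, and `S^j d_0` takes the value `1` at the point `j` of `Δ_1`, because
`F^j(j) = 0` there.
-/

noncomputable section

namespace BourgainDelbaen

/-! ### The projections on all tuples -/

section Projections

variable {k : ℕ}

/-- A functional on the tuples of rank at most `q`, seen as a functional on all tuples. -/
def liftU (q : ℕ) : (Lev k q →₀ ℝ) →ₗ[ℝ] (Univ k →₀ ℝ) := Finsupp.lmapDomain ℝ ℝ (inc q)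

theorem liftU_single (q : ℕ) (v : Lev k q) (a : ℝ) :
    liftU q (Finsupp.single v a) = Finsupp.single (inc q v) a :=
  Finsupp.mapDomain_single

theorem liftU_succ_inl (q : ℕ) (b : Lev k q →₀ ℝ) :
    liftU (q + 1) (Finsupp.mapDomain Sum.inl b) = liftU q b :=
  (Finsupp.mapDomain_comp (f := (Sum.inl : Lev k q → Lev k (q + 1))) (g := inc (q + 1))).symm

theorem rank_inc_le : ∀ (q : ℕ) (v : Lev k q), rank (inc q v) ≤ q
  | 0, v => Empty.elim v
  | q + 1, Sum.inl v => (rank_inc_le q v).trans (Nat.le_succ q)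
  | _ + 1, Sum.inr _ => le_rfl

theorem exists_inc_of_mem_support_liftU {q : ℕ} {b : Lev k q →₀ ℝ} {γ : Univ k}
    (h : γ ∈ (liftU q b).support) : ∃ v ∈ b.support, inc q v = γ := by
  classical
  exact Finset.mem_image.1 (Finsupp.mapDomain_support h)

/-- The projection `P^*_{(0,p]}` on the finitely supported functionals on all tuples. -/
def projU (p : ℕ) : (Univ k →₀ ℝ) →ₗ[ℝ] (Univ k →₀ ℝ) :=
  Finsupp.linearCombination ℝ fun γ : Univ k =>
    liftU (γ.1 + 1) (proj (γ.1 + 1) p (Finsupp.single (Sum.inr γ.2) 1))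

theorem projU_single (p : ℕ) (γ : Univ k) : projU p (Finsupp.single γ 1)
    = liftU (γ.1 + 1) (proj (γ.1 + 1) p (Finsupp.single (Sum.inr γ.2) 1)) :=
  (Finsupp.linearCombination_single ℝ 1 γ).trans (one_smul ℝ _)

theorem proj_succ_inr (q p : ℕ) (t : Tup k (Lev k q)) (h : ¬ q + 1 ≤ p) :
    proj (q + 1) p (Finsupp.single (Sum.inr t) 1)
      = Finsupp.mapDomain Sum.inl (proj q p (cOf q (proj q) t)) :=
  (Finsupp.linearCombination_single ℝ 1 (Sum.inr t)).trans
    ((one_smul ℝ _).trans (if_neg h))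

theorem proj_succ_inl (q p : ℕ) (c : Lev k q →₀ ℝ) :
    proj (q + 1) p (Finsupp.mapDomain Sum.inl c) = Finsupp.mapDomain Sum.inl (proj q p c) := by
  induction c using Finsupp.induction_linear with
  | zero => simp
  | add f g hf hg => simp only [Finsupp.mapDomain_add, map_add, hf, hg]
  | single v r =>
    rw [Finsupp.mapDomain_single, ← mul_one r, ← smul_eq_mul, ← Finsupp.smul_single,
      ← Finsupp.smul_single, map_smul, map_smul, Finsupp.mapDomain_smul]
    simp [proj]

theorem projU_liftU (p : ℕ) : ∀ (q : ℕ) (b : Lev k q →₀ ℝ),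
    projU p (liftU q b) = liftU q (proj q p b) := by
  intro q
  suffices h : projU p ∘ₗ liftU q = (liftU q : (Lev k q →₀ ℝ) →ₗ[ℝ] _) ∘ₗ proj q p from
    fun b => LinearMap.congr_fun h b
  induction q with
  | zero => exact Finsupp.lhom_ext' fun v => Empty.elim v
  | succ q ih =>
    refine Finsupp.lhom_ext' fun w => LinearMap.ext_ring ?_
    rcases w with v | t
    · have h := LinearMap.congr_fun ih (Finsupp.single v 1)
      simp only [LinearMap.comp_apply] at h
      have e : (Finsupp.single (Sum.inl v) 1 : Lev k (q + 1) →₀ ℝ)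
          = Finsupp.mapDomain Sum.inl (Finsupp.single v 1) := Finsupp.mapDomain_single.symm
      simp only [LinearMap.comp_apply, Finsupp.lsingle_apply]
      rw [e, proj_succ_inl, liftU_succ_inl, liftU_succ_inl, h]
    · simp only [LinearMap.comp_apply, Finsupp.lsingle_apply]
      rw [liftU_single]
      exact projU_single p ⟨q, t⟩

theorem projU_single_of_le {p : ℕ} {γ : Univ k} (h : rank γ ≤ p) :
    projU p (Finsupp.single γ 1) = Finsupp.single γ 1 := by
  have h' : γ.1 + 1 ≤ p := h
  rw [projU_single, proj_of_le _ _ h', LinearMap.id_apply]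
  exact liftU_single _ _ _

theorem projU_single_of_lt {p : ℕ} {γ : Univ k} (h : p < rank γ) :
    projU p (Finsupp.single γ 1) = projU p (cStar γ) := by
  have h' : ¬ γ.1 + 1 ≤ p := not_le.2 h
  have e : cStar γ = liftU γ.1 (cOf γ.1 (proj γ.1) γ.2) := rfl
  rw [e, projU_liftU, projU_single, proj_succ_inr _ _ _ h', liftU_succ_inl]

theorem cStar_base (q : ℕ) (i : Fin k) : cStar ⟨q, Tup.base i⟩ = 0 := by
  simp [cStar, cOf]

theorem cStar_one (q p : ℕ) (β : ℝ) (b : Lev k q →₀ ℝ) :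
    cStar ⟨q, Tup.one p β b⟩ = β • (liftU q b - projU p (liftU q b)) := by
  rw [projU_liftU, ← map_sub, ← map_smul]
  rfl

theorem cStar_two (q : ℕ) (ξ : Lev k q) (β : ℝ) (b : Lev k q →₀ ℝ) :
    cStar ⟨q, Tup.two ξ β b⟩ = Finsupp.single (inc q ξ) 1
      + β • (liftU q b - projU (rank (inc q ξ)) (liftU q b)) := by
  rw [projU_liftU, ← map_sub, ← map_smul, ← liftU_single, ← map_add]
  rfl

theorem rank_lt_of_mem_support_cStar {γ δ : Univ k} (h : δ ∈ (cStar γ).support) :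
    rank δ < rank γ := by
  obtain ⟨v, -, rfl⟩ := exists_inc_of_mem_support_liftU h
  exact Nat.lt_succ_of_le (rank_inc_le _ v)

theorem rank_induction {motive : Univ k → Prop}
    (h : ∀ γ, (∀ δ, rank δ < rank γ → motive δ) → motive γ) (γ : Univ k) : motive γ :=
  (measure (rank (k := k))).wf.induction γ h

/-- Linear maps that agree on the unit vectors `e_v^*` with `v ∈ supp b` agree on `b`. -/
theorem linearMap_congr_support {V M : Type*} [AddCommGroup M] [Module ℝ M]
    {A B : (V →₀ ℝ) →ₗ[ℝ] M} {b : V →₀ ℝ}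
    (h : ∀ v ∈ b.support, A (Finsupp.single v 1) = B (Finsupp.single v 1)) : A b = B b := by
  rw [← Finsupp.sum_single b, Finsupp.sum, map_sum, map_sum]
  refine Finset.sum_congr rfl fun v hv => ?_
  rw [← mul_one (b v), ← smul_eq_mul, ← Finsupp.smul_single, map_smul, map_smul, h v hv]

theorem projU_projU (p r : ℕ) (b : Univ k →₀ ℝ) :
    projU p (projU r b) = projU (min p r) b := by
  suffices h : ∀ γ : Univ k, projU p (projU r (Finsupp.single γ 1))
      = projU (min p r) (Finsupp.single γ 1) from
    linearMap_congr_support (A := projU p ∘ₗ projU r) fun γ _ => h γ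
  refine rank_induction fun γ ih => ?_
  rcases le_or_gt (rank γ) r with hr | hr
  · rw [projU_single_of_le hr]
    rcases le_or_gt (rank γ) p with hp | hp
    · rw [projU_single_of_le hp, projU_single_of_le (le_min hp hr)]
    · rw [min_eq_left (hp.le.trans hr)]
  · rw [projU_single_of_lt hr, projU_single_of_lt ((min_le_right p r).trans_lt hr)]
    exact linearMap_congr_support (A := projU p ∘ₗ projU r) fun δ hδ =>
      ih δ (rank_lt_of_mem_support_cStar hδ)

/-- Biorthogonality, at the level of finitely supported functionals: the coordinate at `γ` of
`P^*_{(0, rank γ]} d_θ^*` is `1` if `θ = γ` and `0` otherwise. -/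
theorem projU_rank_dStar_apply (γ θ : Univ k) :
    projU (rank γ) (dStar θ) γ = Finsupp.single θ (1 : ℝ) γ := by
  rcases le_or_gt (rank θ) (rank γ) with h | h
  · have hc : projU (rank γ) (cStar θ) = cStar θ :=
      linearMap_congr_support (B := LinearMap.id) fun δ hδ =>
        projU_single_of_le ((rank_lt_of_mem_support_cStar hδ).le.trans h)
    have h0 : cStar θ γ = 0 := by
      by_contra hne
      exact absurd (rank_lt_of_mem_support_cStar (Finsupp.mem_support_iff.2 hne)) (not_lt.2 h)
    rw [dStar, map_sub, projU_single_of_le h, hc, Finsupp.sub_apply, h0, sub_zero]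
  · have hne : θ ≠ γ := fun e => absurd h (by rw [e]; exact lt_irrefl _)
    rw [dStar, map_sub, projU_single_of_lt h, sub_self, Finsupp.single_eq_of_ne' hne]
    rfl

end Projections

/-! ### The coding map commutes with the projections -/

section Coding

variable {k : ℕ}

theorem pushFin_single {V : Type} (g : V → Option V) (v : V) :
    pushFin g (Finsupp.single v 1) = (g v).elim 0 fun w => Finsupp.single w 1 := by
  simp [pushFin]

theorem pushFin_code_liftU (q : ℕ) (b : Lev k q →₀ ℝ) :
    pushFin code (liftU q b) = liftU q (pushFin (codeLev q) b) := by
  refine linearMap_congr_support (A := pushFin code ∘ₗ liftU q)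
    (B := liftU q ∘ₗ pushFin (codeLev q)) fun v _ => ?_
  rw [LinearMap.comp_apply, LinearMap.comp_apply, liftU_single, pushFin_single, pushFin_single,
    code_inc]
  cases codeLev q v with
  | none => simp
  | some w => simp [liftU_single]

theorem code_inc_of_codeLev {q : ℕ} {v w : Lev k q} (h : codeLev q v = some w) :
    code (inc q v) = some (inc q w) := by
  rw [code_inc, h]
  rfl

theorem code_eq_none {q : ℕ} {t : Tup k (Lev k q)} (h : codeStep q (codeLev q) t = none) :
    code ⟨q, t⟩ = none :=
  congrArg (Option.map fun t => (⟨q, t⟩ : Univ k)) h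

theorem code_eq_some {q : ℕ} {t t' : Tup k (Lev k q)}
    (h : codeStep q (codeLev q) t = some t') : code ⟨q, t⟩ = some ⟨q, t'⟩ :=
  congrArg (Option.map fun t => (⟨q, t⟩ : Univ k)) h

/-- If `R^*` commutes with the projections on functionals of rank at most `q`, then
`R^* c_γ^* = c_{G(γ)}^*` for `γ` of rank `q + 1`, with `0` on the right if `G(γ)` is undefined:
the condition under which `G(γ)` is undefined is exactly that `R^* c_γ^* = 0`. -/
theorem pushFin_code_cStar_aux (γ : Univ k)
    (ih : ∀ δ : Univ k, rank δ < rank γ → ∀ p,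
      pushFin code (projU p (Finsupp.single δ 1)) = projU p (pushFin code (Finsupp.single δ 1))) :
    pushFin code (cStar γ) = (code γ).elim 0 cStar := by
  obtain ⟨q, t⟩ := γ
  have comm : ∀ p (b : Lev k q →₀ ℝ), pushFin code (projU p (liftU q b))
      = projU p (liftU q (pushFin (codeLev q) b)) := by
    intro p b
    rw [← pushFin_code_liftU]
    refine linearMap_congr_support (A := pushFin code ∘ₗ projU p)
      (B := projU p ∘ₗ pushFin code) fun δ hδ => ih δ ?_ p
    obtain ⟨v, -, rfl⟩ := exists_inc_of_mem_support_liftU hδ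
    exact Nat.lt_succ_of_le (rank_inc_le q v)
  cases t with
  | base i =>
    rw [cStar_base, map_zero]
    by_cases hi : i.1 = 0
    · rw [code_eq_none (by simp [codeStep, hi])]
      rfl
    · rw [code_eq_some (t' := Tup.base ⟨i.1 - 1, by omega⟩) (by simp [codeStep, hi])]
      exact (cStar_base _ _).symm
  | one p β b =>
    rw [cStar_one, map_smul, map_sub, comm, pushFin_code_liftU]
    by_cases h : pushFin (codeLev q) b - proj q p (pushFin (codeLev q) b) = 0
    · rw [projU_liftU, ← map_sub, h, code_eq_none (by simp [codeStep, h]), map_zero, smul_zero]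
      rfl
    · rw [code_eq_some (t' := Tup.one p β (pushFin (codeLev q) b)) (by simp [codeStep, h])]
      exact (cStar_one _ _ _ _).symm
  | two ξ β b =>
    rw [cStar_two, map_add, map_smul, map_sub, comm, pushFin_code_liftU, pushFin_single,
      code_inc]
    rcases hξ : codeLev q ξ with _ | ξ'
    · rw [Option.map_none, Option.elim_none, zero_add]
      by_cases h : pushFin (codeLev q) b
          - proj q (rank (inc q ξ)) (pushFin (codeLev q) b) = 0
      · rw [projU_liftU, ← map_sub, h, code_eq_none (by simp [codeStep, h, hξ]), map_zero,
          smul_zero]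
        rfl
      · rw [code_eq_some (t' := Tup.one (rank (inc q ξ)) β (pushFin (codeLev q) b))
          (by simp [codeStep, h, hξ])]
        exact (cStar_one _ _ _ _).symm
    · rw [code_eq_some (t' := Tup.two ξ' β (pushFin (codeLev q) b)) (by simp [codeStep, hξ]),
        Option.map_some, Option.elim_some, ← rank_code (code_inc_of_codeLev hξ)]
      exact (cStar_two _ _ _ _).symm

theorem pushFin_code_projU (p : ℕ) (b : Univ k →₀ ℝ) :
    pushFin code (projU p b) = projU p (pushFin code b) := by
  suffices h : ∀ γ : Univ k, ∀ p, pushFin code (projU p (Finsupp.single γ 1))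
      = projU p (pushFin code (Finsupp.single γ 1)) from
    linearMap_congr_support (A := pushFin code ∘ₗ projU p)
      (B := projU p ∘ₗ pushFin code) fun γ _ => h γ p
  refine rank_induction fun γ ih p => ?_
  have hc := pushFin_code_cStar_aux γ ih
  rcases le_or_gt (rank γ) p with h | h
  · rw [projU_single_of_le h, pushFin_single]
    rcases hδ : code γ with _ | δ
    · simp
    · exact (projU_single_of_le ((rank_code hδ).trans_le h)).symm
  · have e : pushFin code (projU p (cStar γ)) = projU p (pushFin code (cStar γ)) :=
      linearMap_congr_support (A := pushFin code ∘ₗ projU p)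
        (B := projU p ∘ₗ pushFin code) fun δ hδ => ih δ (rank_lt_of_mem_support_cStar hδ) p
    rw [projU_single_of_lt h, e, hc, pushFin_single]
    rcases hδ : code γ with _ | δ
    · simp
    · exact (projU_single_of_lt (h.trans_eq (rank_code hδ).symm)).symm

/-- `R^* d_γ^* = d_{G(γ)}^*`, or `0` if `G(γ)` is undefined. -/
theorem pushFin_code_dStar (γ : Univ k) :
    pushFin code (dStar γ) = (code γ).elim 0 dStar := by
  rw [dStar, map_sub, pushFin_single,
    pushFin_code_cStar_aux γ fun δ _ p => pushFin_code_projU p _]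
  cases code γ <;> simp [dStar]

end Coding

/-! ### The projections are bounded -/

section Bound

/-- The norm of `ℓ_1` on finitely supported functionals. -/
def sumAbs {V : Type} (b : V →₀ ℝ) : ℝ := b.sum fun _ a => |a|

theorem sumAbs_eq {V : Type} (b : V →₀ ℝ) : sumAbs b = ∑ v ∈ b.support, |b v| := rfl

theorem sumAbs_single {V : Type} (v : V) : sumAbs (Finsupp.single v 1) = 1 := by
  simp [sumAbs]

theorem sumAbs_nonneg {V : Type} (b : V →₀ ℝ) : 0 ≤ sumAbs b :=
  Finset.sum_nonneg fun _ _ => abs_nonneg _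

theorem abs_apply_le_sumAbs {V : Type} (b : V →₀ ℝ) (v : V) : |b v| ≤ sumAbs b := by
  by_cases hv : v ∈ b.support
  · exact Finset.single_le_sum (f := fun v => |b v|) (fun _ _ => abs_nonneg _) hv
  · rw [Finsupp.notMem_support_iff.1 hv, abs_zero]
    exact sumAbs_nonneg b

theorem sumAbs_smul {V : Type} (c : ℝ) (b : V →₀ ℝ) : sumAbs (c • b) = |c| * sumAbs b := by
  rw [sumAbs, Finsupp.sum_of_support_subset _ Finsupp.support_smul _ (by simp), sumAbs_eq,
    Finset.mul_sum]
  exact Finset.sum_congr rfl fun v _ => by rw [Finsupp.smul_apply, smul_eq_mul, abs_mul]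

theorem sumAbs_sub_le {V : Type} (f g : V →₀ ℝ) : sumAbs (f - g) ≤ sumAbs f + sumAbs g := by
  rw [sub_eq_add_neg]
  refine (sum_abs_add_le f (-g)).trans_eq ?_
  change sumAbs f + sumAbs (-g) = _
  rw [← neg_one_smul ℝ g, sumAbs_smul, abs_neg, abs_one, one_mul]

theorem sumAbs_map_le {V W : Type} (A : (V →₀ ℝ) →ₗ[ℝ] (W →₀ ℝ)) {C : ℝ} {b : V →₀ ℝ}
    (h : ∀ v ∈ b.support, sumAbs (A (Finsupp.single v 1)) ≤ C) :
    sumAbs (A b) ≤ C * sumAbs b := by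
  classical
  have e : A b = ∑ v ∈ b.support, b v • A (Finsupp.single v 1) := by
    conv_lhs => rw [← Finsupp.sum_single b, Finsupp.sum, map_sum]
    refine Finset.sum_congr rfl fun v _ => ?_
    rw [← map_smul, Finsupp.smul_single, smul_eq_mul, mul_one]
  rw [e, sumAbs_eq b, Finset.mul_sum]
  generalize hs : b.support = s at h
  clear hs e
  induction s using Finset.induction_on with
  | empty => simp [sumAbs]
  | insert v s hv ih =>
    rw [Finset.sum_insert hv, Finset.sum_insert hv]
    refine (sum_abs_add_le _ _).trans (add_le_add ?_ (ih fun w hw => h w (by simp [hw])))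
    change sumAbs _ ≤ _
    rw [sumAbs_smul, mul_comm]
    exact mul_le_mul_of_nonneg_right (h v (by simp)) (abs_nonneg _)

variable {k : ℕ} {m n N : ℕ → ℕ}

theorem Growth.four_le (h : Growth m n) {j : ℕ} (hj : 1 ≤ j) : 4 ≤ m j := by
  induction j, hj using Nat.le_induction with
  | base => exact h.m_one
  | succ j hj ih => exact ih.trans (h.m_strict j hj).le

/-- The projections `P^*_{(0,p]}` have norm at most `2`.  The induction on the rank closes because
all weights are at most `1/4`: for `γ = (q + 1, ξ, β, b)` and `rank ξ < p ≤ q`, the functional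
`P^*_{(0,p]} e_γ^*` is `e_ξ^* + β (P^*_{(0,p]} b - P^*_{(0,rank ξ]} b)`, of norm at most
`1 + (2 + 2) / 4`. -/
theorem sumAbs_projU_single_le (h : Growth m n) {γ : Univ k} (hγ : IsMax k m n N γ) (p : ℕ) :
    sumAbs (projU p (Finsupp.single γ 1)) ≤ 2 := by
  have bound : ∀ (q : ℕ) (b : Lev k q →₀ ℝ), IsCoef (N q) b →
      (∀ v ∈ b.support, ∀ p, sumAbs (projU p (Finsupp.single (inc q v) 1)) ≤ 2) →
      ∀ j, 1 ≤ j → ∀ p r, sumAbs ((m j : ℝ)⁻¹ • (projU p (liftU q b) - projU r (liftU q b))) ≤ 1 := by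
    intro q b hb ih j hj p r
    have hP : ∀ p, sumAbs (projU p (liftU q b)) ≤ 2 := fun p => by
      have := sumAbs_map_le (projU p ∘ₗ liftU q) (b := b) (C := 2) fun v hv => by
        rw [LinearMap.comp_apply, liftU_single]
        exact ih v hv p
      refine this.trans ?_
      have h1 : sumAbs b ≤ 1 := hb.1
      linarith
    have hm : (m j : ℝ)⁻¹ ≤ 4⁻¹ :=
      inv_anti₀ (by norm_num) (by exact_mod_cast h.four_le hj)
    have hm0 : (0 : ℝ) ≤ (m j : ℝ)⁻¹ := by positivity
    rw [sumAbs_smul, abs_of_nonneg hm0]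
    refine (mul_le_mul hm ((sumAbs_sub_le _ _).trans (add_le_add (hP p) (hP r)))
      (sumAbs_nonneg _) (by norm_num)).trans ?_
    norm_num
  have of_le : ∀ {γ : Univ k} {p}, rank γ ≤ p → sumAbs (projU p (Finsupp.single γ 1)) ≤ 2 := by
    intro γ p hp
    rw [projU_single_of_le hp, sumAbs_single]
    norm_num
  induction hγ generalizing p with
  | base i =>
    rcases le_or_gt (rank (⟨0, Tup.base i⟩ : Univ k)) p with hp | hp
    · exact of_le hp
    · rw [projU_single_of_lt hp, cStar_base, map_zero]
      simp [sumAbs]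
  | one q r j b hj _ _ _ _ hcoef ih =>
    rcases le_or_gt (rank (⟨q, Tup.one r (m j : ℝ)⁻¹ b⟩ : Univ k)) p with hp | hp
    · exact of_le hp
    · rw [projU_single_of_lt hp, cStar_one, map_smul, map_sub, projU_projU]
      exact (bound q b hcoef ih j hj _ _).trans (by norm_num)
  | two q j ξ b hj _ _ _ _ _ _ _ hcoef ihξ ih =>
    rcases le_or_gt (rank (⟨q, Tup.two ξ (m j : ℝ)⁻¹ b⟩ : Univ k)) p with hp | hp
    · exact of_le hp
    · rw [projU_single_of_lt hp, cStar_two, map_add, map_smul, map_sub, projU_projU]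
      rcases le_or_gt (rank (inc q ξ)) p with hξp | hξp
      · rw [projU_single_of_le hξp]
        refine (sum_abs_add_le _ _).trans ?_
        have h1 := sumAbs_single (inc q ξ)
        have h2 := bound q b hcoef ih j hj p (min p (rank (inc q ξ)))
        unfold sumAbs at h1 h2
        linarith
      · rw [min_eq_left hξp.le, sub_self, smul_zero, add_zero]
        exact ihξ p

end Bound

/-! ### Functionals supported in the index set -/

section Support

variable {k : ℕ} {m n N : ℕ → ℕ} {σ : GammaMax k m n N → ℕ}

theorem IsGam.of_mem_support_one {q p : ℕ} {β : ℝ} {b : Lev k q →₀ ℝ}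
    (h : IsGam σ ⟨q, Tup.one p β b⟩) : ∀ v ∈ b.support, IsGam σ (inc q v) := by
  classical
  cases h with
  | evenOne q p j b hj hjq hp hmem => exact hmem
  | oddOneZero => simp
  | oddOne q p j i η hj hjq hp hη =>
    intro v hv
    obtain rfl := Finset.mem_singleton.1 (Finsupp.support_single_subset hv)
    exact hη

theorem IsGam.of_mem_support_two {q : ℕ} {ξ : Lev k q} {β : ℝ} {b : Lev k q →₀ ℝ}
    (h : IsGam σ ⟨q, Tup.two ξ β b⟩) :
    IsGam σ (inc q ξ) ∧ ∀ v ∈ b.support, IsGam σ (inc q v) := by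
  classical
  cases h with
  | evenTwo => exact ⟨by assumption, by assumption⟩
  | oddTwoZero => exact ⟨by assumption, by simp⟩
  | oddTwo q j i ξ η hj hjξ hξq hξ hw hage hη =>
    refine ⟨hξ, fun v hv => ?_⟩
    obtain rfl := Finset.mem_singleton.1 (Finsupp.support_single_subset hv)
    exact hη

variable (σ) in
/-- The finitely supported functionals that are supported in `Γ`. -/
def gamSupported : Submodule ℝ (Univ k →₀ ℝ) := Finsupp.supported ℝ ℝ {γ | IsGam σ γ}

theorem mem_gamSupported {b : Univ k →₀ ℝ} :
    b ∈ gamSupported σ ↔ ∀ γ ∈ b.support, IsGam σ γ := Iff.rfl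

theorem single_mem_gamSupported {γ : Univ k} (h : IsGam σ γ) :
    Finsupp.single γ 1 ∈ gamSupported σ :=
  Finsupp.single_mem_supported ℝ 1 h

theorem liftU_mem_gamSupported {q : ℕ} {b : Lev k q →₀ ℝ}
    (h : ∀ v ∈ b.support, IsGam σ (inc q v)) : liftU q b ∈ gamSupported σ := by
  refine mem_gamSupported.2 fun γ hγ => ?_
  obtain ⟨v, hv, rfl⟩ := exists_inc_of_mem_support_liftU hγ
  exact h v hv

theorem map_mem_of_support {M : Type*} [AddCommGroup M] [Module ℝ M] {V : Type}
    (A : (V →₀ ℝ) →ₗ[ℝ] M) (W : Submodule ℝ M) {b : V →₀ ℝ}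
    (h : ∀ v ∈ b.support, A (Finsupp.single v 1) ∈ W) : A b ∈ W := by
  rw [← Finsupp.sum_single b, Finsupp.sum, map_sum]
  refine W.sum_mem fun v hv => ?_
  rw [← mul_one (b v), ← smul_eq_mul, ← Finsupp.smul_single, map_smul]
  exact W.smul_mem _ (h v hv)

theorem cStar_mem_gamSupported_aux {γ : Univ k} (hγ : IsGam σ γ)
    (ih : ∀ δ : Univ k, rank δ < rank γ → IsGam σ δ →
      ∀ p, projU p (Finsupp.single δ 1) ∈ gamSupported σ) : cStar γ ∈ gamSupported σ := by
  obtain ⟨q, t⟩ := γ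
  have hP : ∀ b : Lev k q →₀ ℝ, (∀ v ∈ b.support, IsGam σ (inc q v)) → ∀ p,
      projU p (liftU q b) ∈ gamSupported σ := fun b hb p =>
    map_mem_of_support (projU p ∘ₗ liftU q) _ fun v hv => by
      rw [LinearMap.comp_apply, liftU_single]
      exact ih _ (Nat.lt_succ_of_le (rank_inc_le q v)) (hb v hv) p
  cases t with
  | base i => rw [cStar_base]; exact zero_mem _
  | one p β b =>
    have hb := hγ.of_mem_support_one
    rw [cStar_one]
    exact Submodule.smul_mem _ _ (sub_mem (liftU_mem_gamSupported hb) (hP b hb _))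
  | two ξ β b =>
    obtain ⟨hξ, hb⟩ := hγ.of_mem_support_two
    rw [cStar_two]
    exact add_mem (single_mem_gamSupported hξ)
      (Submodule.smul_mem _ _ (sub_mem (liftU_mem_gamSupported hb) (hP b hb _)))

theorem projU_single_mem_gamSupported {γ : Univ k} (hγ : IsGam σ γ) :
    ∀ p, projU p (Finsupp.single γ 1) ∈ gamSupported σ := by
  induction γ using rank_induction with
  | h γ ih =>
    intro p
    rcases le_or_gt (rank γ) p with hp | hp
    · rw [projU_single_of_le hp]
      exact single_mem_gamSupported hγ
    · rw [projU_single_of_lt hp]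
      have hc := cStar_mem_gamSupported_aux hγ fun δ hδ hG => ih δ hδ hG
      exact map_mem_of_support _ _ fun δ hδ =>
        ih δ (rank_lt_of_mem_support_cStar hδ) (mem_gamSupported.1 hc δ hδ) p

theorem cStar_mem_gamSupported {γ : Univ k} (hγ : IsGam σ γ) : cStar γ ∈ gamSupported σ :=
  cStar_mem_gamSupported_aux hγ fun _ _ h => projU_single_mem_gamSupported h

theorem dStar_mem_gamSupported {γ : Univ k} (hγ : IsGam σ γ) : dStar γ ∈ gamSupported σ :=
  sub_mem (single_mem_gamSupported hγ) (cStar_mem_gamSupported hγ)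

end Support

/-! ### The coding map is nilpotent -/

section Nilpotent

/-- The `j`-th iterate of a partial map, applied to a possibly undefined point. -/
def iterBind {V : Type} (g : V → Option V) (j : ℕ) (o : Option V) : Option V :=
  (fun o : Option V => o.bind g)^[j] o

theorem iterBind_succ {V : Type} (g : V → Option V) (j : ℕ) (o : Option V) :
    iterBind g (j + 1) o = (iterBind g j o).bind g :=
  Function.iterate_succ_apply' _ j o

theorem iterBind_succ' {V : Type} (g : V → Option V) (j : ℕ) (o : Option V) :
    iterBind g (j + 1) o = iterBind g j (o.bind g) :=
  Function.iterate_succ_apply _ j o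

theorem iterBind_map {V W : Type} {g : V → Option V} {g' : W → Option W} {f : V → W}
    (h : ∀ v, g' (f v) = (g v).map f) (j : ℕ) (o : Option V) :
    iterBind g' j (o.map f) = (iterBind g j o).map f := by
  induction j with
  | zero => rfl
  | succ j ih =>
    rw [iterBind_succ, iterBind_succ, ih]
    cases iterBind g j o with
    | none => rfl
    | some v => exact h v

/-- Once undefined, the iterates of a partial map remain undefined. -/
theorem iterBind_eq_none_of_le {V : Type} {g : V → Option V} {o : Option V} {i j : ℕ}
    (h : iterBind g i o = none) (hij : i ≤ j) : iterBind g j o = none := by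
  induction j, hij using Nat.le_induction with
  | base => exact h
  | succ j _ ih => rw [iterBind_succ, ih]; rfl

theorem iterate_pushFin_single {V : Type} (g : V → Option V) (j : ℕ) (v : V) :
    (pushFin g ^ j) (Finsupp.single v 1)
      = (iterBind g j (some v)).elim 0 fun w => Finsupp.single w 1 := by
  induction j with
  | zero => rfl
  | succ j ih =>
    rw [pow_succ', Module.End.mul_apply, ih, iterBind_succ]
    cases iterBind g j (some v) with
    | none => simp
    | some w => exact pushFin_single g w

variable {k : ℕ}

/-- The shape of `G^j(γ)`, in terms of the last coordinates: the functional of `G^j(γ)` is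
`(R^*)^j b`, and the first coordinate of a tuple `(n + 1, ξ, β, b)` remains of this kind only as
long as `G^j(ξ)` is defined. -/
theorem iterBind_codeStep {q : ℕ} {g : Lev k q → Option (Lev k q)} {j : ℕ}
    {t t' : Tup k (Lev k q)} (h : iterBind (codeStep q g) j (some t) = some t') :
    match (generalizing := false) t with
    | Tup.base i => ∃ i' : Fin k, t' = Tup.base i' ∧ i'.1 + j = i.1
    | Tup.one p β b => t' = Tup.one p β ((pushFin g ^ j) b) ∧ (0 < j → (pushFin g ^ j) b ≠ 0)
    | Tup.two ξ β b =>
      (∃ ξ', iterBind g j (some ξ) = some ξ' ∧ t' = Tup.two ξ' β ((pushFin g ^ j) b)) ∨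
      (∃ p, t' = Tup.one p β ((pushFin g ^ j) b) ∧ (pushFin g ^ j) b ≠ 0) := by
  induction j generalizing t' with
  | zero =>
    obtain rfl := Option.some.inj h
    cases t with
    | base i => exact ⟨i, rfl, rfl⟩
    | one p β b => exact ⟨rfl, fun h => absurd h (lt_irrefl 0)⟩
    | two ξ β b => exact Or.inl ⟨ξ, rfl, rfl⟩
  | succ j ih =>
    rw [iterBind_succ] at h
    obtain ⟨u, hu, hut⟩ := Option.bind_eq_some_iff.1 h
    have ne_zero : ∀ (p : ℕ) (b : Lev k q →₀ ℝ), ¬ b - proj q p b = 0 → b ≠ 0 := by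
      rintro p b hb rfl
      exact hb (by simp)
    have step_one : ∀ (p : ℕ) (β : ℝ) (b : Lev k q →₀ ℝ), u = Tup.one p β ((pushFin g ^ j) b) →
        t' = Tup.one p β ((pushFin g ^ (j + 1)) b) ∧ (pushFin g ^ (j + 1)) b ≠ 0 := by
      rintro p β b rfl
      simp only [codeStep] at hut
      split_ifs at hut with hne
      rw [pow_succ', Module.End.mul_apply]
      exact ⟨(Option.some.inj hut).symm, ne_zero _ _ hne⟩
    specialize ih hu
    cases t with
    | base i =>
      obtain ⟨i', rfl, hi'⟩ := ih
      simp only [codeStep] at hut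
      split_ifs at hut with hne
      obtain rfl := Option.some.inj hut
      exact ⟨_, rfl, by simp only; omega⟩
    | one p β b =>
      obtain ⟨h1, h2⟩ := step_one p β b ih.1
      exact ⟨h1, fun _ => h2⟩
    | two ξ β b =>
      rcases ih with ⟨ξ', hξ', rfl⟩ | ⟨p, rfl, -⟩
      · simp only [codeStep] at hut
        simp only [pow_succ', Module.End.mul_apply]
        split at hut
        · rename_i ξ'' hξ''
          refine Or.inl ⟨ξ'', ?_, (Option.some.inj hut).symm⟩
          rw [iterBind_succ, hξ']
          exact hξ''
        · split_ifs at hut with hne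
          exact Or.inr ⟨_, (Option.some.inj hut).symm, ne_zero _ _ hne⟩
      · obtain ⟨h1, h2⟩ := step_one p β b rfl
        exact Or.inr ⟨p, h1, h2⟩

theorem iterBind_codeStep_eq_none (hk : 0 < k) {q : ℕ} {g : Lev k q → Option (Lev k q)}
    (hg : ∀ v, iterBind g k (some v) = none) (t : Tup k (Lev k q)) :
    iterBind (codeStep q g) k (some t) = none := by
  have hpow : ∀ b, (pushFin g ^ k) b = 0 := fun b =>
    linearMap_congr_support (A := pushFin g ^ k) (B := 0) fun v _ => by
      rw [iterate_pushFin_single, hg]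
      rfl
  by_contra hne
  obtain ⟨t', ht'⟩ := Option.ne_none_iff_exists'.1 hne
  have h := iterBind_codeStep ht'
  cases t with
  | base i =>
    obtain ⟨i', -, hi'⟩ := h
    omega
  | one p β b => exact h.2 hk (hpow b)
  | two ξ β b =>
    rcases h with ⟨ξ', hξ', -⟩ | ⟨p, -, hp⟩
    · rw [hg] at hξ'
      cases hξ'
    · exact hp (hpow b)

theorem iterBind_codeLev_eq_none (hk : 0 < k) (q : ℕ) (v : Lev k q) :
    iterBind (codeLev q) k (some v) = none := by
  induction q with
  | zero => exact Empty.elim v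
  | succ q ih =>
    rcases v with v | t
    · have := iterBind_map (g := codeLev q) (g' := codeLev (q + 1)) (f := Sum.inl)
        (fun _ => rfl) k (some v)
      rw [ih v] at this
      exact this
    · have := iterBind_map (g := codeStep q (codeLev q)) (g' := codeLev (q + 1)) (f := Sum.inr)
        (fun _ => rfl) k (some t)
      rw [iterBind_codeStep_eq_none hk ih t] at this
      exact this

/-- `G^k` is nowhere defined. -/
theorem iterBind_code_eq_none (hk : 0 < k) (γ : Univ k) : iterBind code k (some γ) = none := by
  obtain ⟨q, t⟩ := γ
  have := iterBind_map (g := codeStep q (codeLev q)) (g' := code)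
    (f := fun t => (⟨q, t⟩ : Univ k)) (fun _ => rfl) k (some t)
  rw [iterBind_codeStep_eq_none hk (iterBind_codeLev_eq_none hk q) t] at this
  exact this

end Nilpotent

/-! ### Invariance of the index set -/

section Invariance

variable {k : ℕ} {m n N : ℕ → ℕ} {σ : GammaMax k m n N → ℕ}

/-- `Σ(ξ) ⊆ Σ(G(ξ))`: if `G^j(δ) = ξ`, then `G^{j+1}(δ) = G(ξ)` is defined, so that `j + 1 < k`
because `G^k` is nowhere defined. -/
theorem sigmaSet_subset_of_code (hk : 0 < k) {ξ ξ' : Univ k} (h : code ξ = some ξ') :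
    sigmaSet σ ξ ⊆ sigmaSet σ ξ' := by
  rintro s ⟨δ, j, hj, hδ, rfl⟩
  have h1 : iterBind code (j + 1) (some δ.1) = some ξ' := by
    rw [iterBind_succ]
    exact (congrArg (fun o => Option.bind o code) hδ).trans h
  refine ⟨δ, j + 1, ?_, h1, rfl⟩
  by_contra hlt
  rw [iterBind_eq_none_of_le (iterBind_code_eq_none hk δ.1) (by omega)] at h1
  cases h1

/-- `G` maps `Γ` into `Γ ∪ {undefined}`. -/
theorem IsGam.code (hk : 0 < k) (hσ : IsSigma σ) {γ δ : Univ k} (h : IsGam σ γ)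
    (hδ : BourgainDelbaen.code γ = some δ) : IsGam σ δ := by
  have inner : ∀ {q : ℕ} {v w : Lev k q}, codeLev q v = some w →
      BourgainDelbaen.code (inc q v) = some (inc q w) := code_inc_of_codeLev
  have age_le : ∀ {q : ℕ} {v w : Lev k q}, codeLev q v = some w →
      age (inc q w) ≤ age (inc q v) := by
    intro q v w hv
    rw [age_inc, age_inc]
    exact ageLev_codeLev_le q v w hv
  have push_none : ∀ {q : ℕ} {v : Lev k q}, codeLev q v = none →
      pushFin (codeLev q) (Finsupp.single v 1) = 0 := by
    intro q v hv
    rw [pushFin_single, hv]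
    rfl
  have push_some : ∀ {q : ℕ} {v w : Lev k q}, codeLev q v = some w →
      pushFin (codeLev q) (Finsupp.single v 1) = Finsupp.single w 1 := by
    intro q v w hv
    rw [pushFin_single, hv]
    rfl
  induction h generalizing δ with
  | base i =>
    obtain ⟨t, ht, rfl⟩ := Option.map_eq_some_iff.1 hδ
    simp only [codeStep] at ht
    split_ifs at ht
    obtain rfl := Option.some.inj ht
    exact .base _
  | evenOne q p j b hj hjq hp _ hrank hcoef ih =>
    obtain ⟨t, ht, rfl⟩ := Option.map_eq_some_iff.1 hδ
    simp only [codeStep] at ht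
    split_ifs at ht
    obtain rfl := Option.some.inj ht
    refine .evenOne q p j _ hj hjq hp (fun w hw => ?_) (fun w hw => ?_)
        (isCoef_pushFin _ hcoef) <;>
      obtain ⟨v, hv, hvw⟩ := exists_of_mem_support_pushFin hw
    · exact ih v hv (inner hvw)
    · rw [rank_code (inner hvw)]
      exact hrank v hv
  | evenTwo q j ξ b hj hjξ hξq _ hwt hage _ hrank hcoef ihξ ih =>
    obtain ⟨t, ht, rfl⟩ := Option.map_eq_some_iff.1 hδ
    simp only [codeStep] at ht
    split at ht
    · rename_i ξ' hξ'
      obtain rfl := Option.some.inj ht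
      have hc := inner hξ'
      have hr := rank_code hc
      refine .evenTwo q j ξ' _ hj (hr ▸ hjξ) (hr ▸ hξq) (ihξ hc) ((weight_code hc).trans hwt)
        ((age_le hξ').trans_lt hage) (fun w hw => ?_) (fun w hw => ?_)
        (isCoef_pushFin _ hcoef) <;>
        obtain ⟨v, hv, hvw⟩ := exists_of_mem_support_pushFin hw
      · exact ih v hv (inner hvw)
      · rw [rank_code (inner hvw), hr]
        exact hrank v hv
    · split_ifs at ht
      obtain rfl := Option.some.inj ht
      refine .evenOne q _ j _ hj (by omega) hξq (fun w hw => ?_) (fun w hw => ?_)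
        (isCoef_pushFin _ hcoef) <;>
        obtain ⟨v, hv, hvw⟩ := exists_of_mem_support_pushFin hw
      · exact ih v hv (inner hvw)
      · rw [rank_code (inner hvw)]
        exact hrank v hv
  | oddOneZero q p j hj hjq hp =>
    obtain ⟨t, ht, rfl⟩ := Option.map_eq_some_iff.1 hδ
    simp [codeStep] at ht
  | oddOne q p j i η hj hjq hp _ hrank hi hwt hlt ih =>
    obtain ⟨t, ht, rfl⟩ := Option.map_eq_some_iff.1 hδ
    simp only [codeStep] at ht
    rcases hη' : codeLev q η with _ | η'
    · rw [push_none hη'] at ht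
      simp at ht
    · have hc := inner hη'
      rw [push_some hη'] at ht
      split_ifs at ht
      obtain rfl := Option.some.inj ht
      exact .oddOne q p j i η' hj hjq hp (ih hc) ((rank_code hc).symm ▸ hrank) hi
        ((weight_code hc).trans hwt) hlt
  | oddTwoZero q j ξ hj hjξ hξq _ hwt hage ihξ =>
    obtain ⟨t, ht, rfl⟩ := Option.map_eq_some_iff.1 hδ
    rcases hξ' : codeLev q ξ with _ | ξ'
    · simp [codeStep, hξ'] at ht
    · have hc := inner hξ'
      have hr := rank_code hc
      simp only [codeStep, hξ', map_zero] at ht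
      obtain rfl := Option.some.inj ht
      exact .oddTwoZero q j ξ' hj (hr ▸ hjξ) (hr ▸ hξq) (ihξ hc) ((weight_code hc).trans hwt)
        ((age_le hξ').trans_lt hage)
  | oddTwo q j i ξ η hj hjξ hξq _ hwt hage _ hrank hi hwη hlt ihξ ihη =>
    obtain ⟨t, ht, rfl⟩ := Option.map_eq_some_iff.1 hδ
    simp only [codeStep] at ht
    rcases hξ' : codeLev q ξ with _ | ξ'
    · rcases hη' : codeLev q η with _ | η'
      · rw [push_none hη'] at ht
        simp [hξ'] at ht
      · have hc := inner hη'
        rw [push_some hη'] at ht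
        simp only [hξ'] at ht
        split_ifs at ht
        obtain rfl := Option.some.inj ht
        have hi1 : 1 ≤ i := by
          obtain ⟨θ, -, -, -, rfl⟩ := hi
          exact (Nat.zero_le _).trans_lt (hσ.rank_lt θ)
        exact .oddOne q _ j i η' hj (by omega) hξq (ihη hc) ((rank_code hc).symm ▸ hrank) hi1
          ((weight_code hc).trans hwη) hlt
    · have hcξ := inner hξ'
      have hr := rank_code hcξ
      rcases hη' : codeLev q η with _ | η'
      · rw [push_none hη'] at ht
        simp only [hξ'] at ht
        obtain rfl := Option.some.inj ht
        exact .oddTwoZero q j ξ' hj (hr ▸ hjξ) (hr ▸ hξq) (ihξ hcξ)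
          ((weight_code hcξ).trans hwt) ((age_le hξ').trans_lt hage)
      · have hcη := inner hη'
        rw [push_some hη'] at ht
        simp only [hξ'] at ht
        obtain rfl := Option.some.inj ht
        exact .oddTwo q j i ξ' η' hj (hr ▸ hjξ) (hr ▸ hξq) (ihξ hcξ)
          ((weight_code hcξ).trans hwt) ((age_le hξ').trans_lt hage) (ihη hcη)
          (by rw [hr, rank_code hcη]; exact hrank) (sigmaSet_subset_of_code hk hcξ hi)
          ((weight_code hcη).trans hwη) hlt

end Invariance

/-! ### Finitely many elements of each rank -/

section Finite

variable {k : ℕ} {m n N : ℕ → ℕ}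

theorem finite_isCoef {V : Type} (D : ℕ) {A : Set V} (hA : A.Finite) :
    {b : V →₀ ℝ | (∀ v ∈ b.support, v ∈ A) ∧ IsCoef D b}.Finite := by
  classical
  set C : Finset ℝ :=
    Finset.image (fun z : ℤ => (z : ℝ) / (D ! : ℝ)) (Finset.Icc (-(D ! : ℤ)) (D ! : ℤ))
  refine (hA.toFinset.finsupp fun _ => C).finite_toSet.subset ?_
  rintro b ⟨hb, hcoef⟩
  refine Finset.mem_coe.2 (Finset.mem_finsupp_iff.2
    ⟨fun v hv => hA.mem_toFinset.2 (hb v hv), fun v _ => ?_⟩)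
  obtain ⟨z, hz⟩ := hcoef.2 v
  have hD : (0 : ℝ) < (D ! : ℝ) := by exact_mod_cast D.factorial_pos
  have h1 : |(z : ℝ) / (D ! : ℝ)| ≤ 1 := hz ▸ (abs_apply_le_sumAbs b v).trans hcoef.1
  rw [abs_div, abs_of_pos hD, div_le_one hD] at h1
  have h2 : |z| ≤ (D ! : ℤ) := by exact_mod_cast h1
  exact Finset.mem_image.2 ⟨z, Finset.mem_Icc.2 (abs_le.1 h2), hz.symm⟩

theorem finite_isMax_lev (q : ℕ) : {v : Lev k q | IsMax k m n N (inc q v)}.Finite := by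
  induction q with
  | zero => exact Set.toFinite (α := Empty) _
  | succ q ih =>
    have hB := finite_isCoef (N q) ih
    have hJ := Set.finite_Iic (q + 1)
    refine Set.Finite.subset (((ih.image Sum.inl).union
      ((Set.finite_range (fun i : Fin k => (Sum.inr (Tup.base i) : Lev k (q + 1)))).union
      ((((Set.finite_Iio q).prod (hJ.prod hB)).image fun x =>
        (Sum.inr (Tup.one x.1 (m x.2.1 : ℝ)⁻¹ x.2.2) : Lev k (q + 1))).union
      ((ih.prod (hJ.prod hB)).image fun x =>
        (Sum.inr (Tup.two x.1 (m x.2.1 : ℝ)⁻¹ x.2.2) : Lev k (q + 1))))))) ?_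
    rintro (v | t) hv
    · exact Or.inl ⟨v, hv, rfl⟩
    · right
      change IsMax k m n N ⟨q, t⟩ at hv
      cases hv with
      | base i => exact Or.inl ⟨i, rfl⟩
      | one q p j b hj hjq hp hmem hrank hcoef =>
        exact Or.inr (Or.inl ⟨(p, j, b), ⟨hp, hjq, hmem, hcoef⟩, rfl⟩)
      | two q j ξ b hj hjξ hξq hξ hw hage hmem hrank hcoef =>
        exact Or.inr (Or.inr ⟨(ξ, j, b), ⟨hξ, show j ≤ q + 1 by omega, hmem, hcoef⟩, rfl⟩)

theorem finite_isMax_rank (r : ℕ) : {γ : Univ k | IsMax k m n N γ ∧ rank γ = r}.Finite := by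
  refine ((finite_isMax_lev (k := k) (m := m) (n := n) (N := N) r).image (inc r)).subset ?_
  rintro ⟨q, t⟩ ⟨hγ, rfl⟩
  exact ⟨Sum.inr t, hγ, rfl⟩

end Finite

/-! ### The duality between `ℓ_∞` and `ℓ_1` -/

section Duality

variable {α β : Type}

theorem hasSum_eStar (y : L1 α) : HasSum (fun a => y a • eStar a) y := by
  classical
  have h := lp.hasSum_single (E := fun _ : α => ℝ) (p := 1) ENNReal.one_ne_top y
  convert h using 2 with a
  rw [eStar, ← lp.single_smul, smul_eq_mul, mul_one]

theorem continuousLinearMap_ext_eStar {E : Type*} [NormedAddCommGroup E] [NormedSpace ℝ E]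
    {A B : L1 α →L[ℝ] E} (h : ∀ a, A (eStar a) = B (eStar a)) : A = B := by
  ext y
  refine (A.hasSum (hasSum_eStar y)).unique ?_
  convert B.hasSum (hasSum_eStar y) using 2 with a
  rw [map_smul, map_smul, h]

theorem norm_push_le (f : α → Option β) : ‖push f‖ ≤ 1 :=
  LinearMap.mkContinuous_norm_le _ zero_le_one _

theorem norm_coord_mul_le (x : LInf α) (y : L1 α) (a : α) : ‖x a * y a‖ ≤ ‖x‖ * ‖y a‖ := by
  rw [norm_mul]
  exact mul_le_mul_of_nonneg_right (lp.norm_apply_le_norm ENNReal.top_ne_zero x a)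
    (norm_nonneg _)

theorem summable_pairing (x : LInf α) (y : L1 α) : Summable fun a => x a * y a :=
  .of_norm_bounded ((summable_coord y).mul_left ‖x‖) (norm_coord_mul_le x y)

/-- The functional on `ℓ_1(α)` given by an element of `ℓ_∞(α)`. -/
def pairingL (x : LInf α) : L1 α →L[ℝ] ℝ :=
  LinearMap.mkContinuous
    { toFun := pairing x
      map_add' := fun y z => by
        rw [pairing, pairing, pairing, ← (summable_pairing x y).tsum_add (summable_pairing x z)]
        exact tsum_congr fun a => by rw [lp.coeFn_add, Pi.add_apply, mul_add]
      map_smul' := fun c y => by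
        rw [RingHom.id_apply, pairing, pairing, smul_eq_mul, ← tsum_mul_left]
        exact tsum_congr fun a => by rw [lp.coeFn_smul, Pi.smul_apply, smul_eq_mul]; ring }
    ‖x‖ fun y => by
      have hn : ‖y‖ = ∑' a, ‖y a‖ := by
        simpa using lp.norm_eq_tsum_rpow (p := 1) (by simp) y
      rw [hn, ← tsum_mul_left]
      exact tsum_of_norm_bounded ((summable_coord y).mul_left ‖x‖).hasSum (norm_coord_mul_le x y)

theorem pairingL_apply (x : LInf α) (y : L1 α) : pairingL x y = pairing x y := rfl

/-- The duality between `ℓ_∞(α)` and `ℓ_1(α)`, as a linear functional of the first argument. -/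
def pairingLeft (y : L1 α) : LInf α →ₗ[ℝ] ℝ where
  toFun x := pairing x y
  map_add' x z := by
    rw [pairing, pairing, pairing, ← (summable_pairing x y).tsum_add (summable_pairing z y)]
    exact tsum_congr fun a => by rw [lp.coeFn_add, Pi.add_apply, add_mul]
  map_smul' c x := by
    rw [RingHom.id_apply, pairing, pairing, smul_eq_mul, ← tsum_mul_left]
    exact tsum_congr fun a => by rw [lp.coeFn_smul, Pi.smul_apply, smul_eq_mul]; ring

theorem pairingLeft_apply (y : L1 α) (x : LInf α) : pairingLeft y x = pairing x y := rfl

theorem pairing_eStar (x : LInf α) (a : α) : pairing x (eStar a) = x a := by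
  classical
  rw [pairing, tsum_eq_single a]
  · simp [eStar]
  · intro b hb
    simp [eStar, lp.single_apply, hb]

/-- The dual operator of `push f`, which maps `x` to `a ↦ x (f a)`, with value `0` at the points
where `f` is undefined. -/
def pull (f : α → Option β) : LInf β →L[ℝ] LInf α :=
  LinearMap.mkContinuous
    { toFun := fun x => ⟨fun a => (f a).elim 0 x, memℓp_infty ⟨‖x‖, by
        rintro _ ⟨a, rfl⟩
        cases h : f a with
        | none => simp [h]
        | some b => simpa [h] using lp.norm_apply_le_norm ENNReal.top_ne_zero x b⟩⟩
      map_add' := fun x z => by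
        ext a
        change (f a).elim (0 : ℝ) ⇑(x + z) = (f a).elim (0 : ℝ) ⇑x + (f a).elim (0 : ℝ) ⇑z
        cases f a with
        | none => exact (add_zero 0).symm
        | some b => rfl
      map_smul' := fun c x => by
        ext a
        change (f a).elim (0 : ℝ) ⇑(c • x) = c * (f a).elim (0 : ℝ) ⇑x
        cases f a with
        | none => exact (mul_zero c).symm
        | some b => rfl }
    1 fun x => by
      rw [one_mul]
      refine lp.norm_le_of_forall_le (norm_nonneg x) fun a => ?_
      change ‖(f a).elim 0 x‖ ≤ _
      cases f a with
      | none => simp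
      | some b => exact lp.norm_apply_le_norm ENNReal.top_ne_zero x b

theorem pull_apply (f : α → Option β) (x : LInf β) (a : α) : pull f x a = (f a).elim 0 x := rfl

theorem norm_pull_le (f : α → Option β) (x : LInf β) : ‖pull f x‖ ≤ ‖x‖ :=
  ((pull f).le_of_opNorm_le (LinearMap.mkContinuous_norm_le _ zero_le_one _) x).trans_eq
    (one_mul _)

theorem pairing_pull (f : α → Option β) (x : LInf β) (y : L1 α) :
    pairing (pull f x) y = pairing x (push f y) := by
  have h : pairingL (pull f x) = (pairingL x).comp (push f) :=
    continuousLinearMap_ext_eStar fun a => by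
      rw [ContinuousLinearMap.comp_apply, push_eStar, pairingL_apply, pairing_eStar, pull_apply,
        image]
      cases f a with
      | none => exact (map_zero _).symm
      | some b => exact (pairing_eStar x b).symm
  exact congrArg (fun A : L1 α →L[ℝ] ℝ => A y) h

theorem pull_pow_apply (f : α → Option α) (j : ℕ) (x : LInf α) (a : α) :
    (pull f ^ j) x a = (iterBind f j (some a)).elim 0 x := by
  induction j generalizing x with
  | zero => rfl
  | succ j ih =>
    rw [pow_succ, mul_apply_eq_comp, ih, iterBind_succ]
    cases iterBind f j (some a) <;> rfl

end Duality

/-! ### The biorthogonal vectors -/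

section Biorthogonal

variable {k : ℕ} {m n N : ℕ → ℕ} {σ : GammaMax k m n N → ℕ}

/-- An element of `ℓ_∞(Γ)` as a functional on the finitely supported functionals on all tuples;
it vanishes on the unit vectors of tuples outside `Γ`. -/
def evalU (x : LInf (Gamma σ)) : (Univ k →₀ ℝ) →ₗ[ℝ] ℝ :=
  open Classical in
  Finsupp.linearCombination ℝ fun γ => if h : IsGam σ γ then x ⟨γ, h⟩ else 0

theorem evalU_single (x : LInf (Gamma σ)) (γ : Gamma σ) :
    evalU x (Finsupp.single γ.1 1) = x γ := by
  simp [evalU, γ.2]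

theorem pairing_dStarGam (x : LInf (Gamma σ)) (γ : Gamma σ) :
    pairing x (dStarGam σ γ) = evalU x (dStar γ.1) := by
  classical
  have hs : ∀ η ∈ (dStar γ.1).support, IsGam σ η :=
    mem_gamSupported.1 (dStar_mem_gamSupported γ.2)
  rw [← pairingL_apply, dStarGam, Finsupp.sum, map_sum]
  rw [evalU, Finsupp.linearCombination_apply, Finsupp.sum, Finsupp.support_subtypeDomain]
  refine (Finset.sum_congr rfl fun η _ => ?_).trans (Finset.sum_subtype_of_mem
    (fun η => dStar γ.1 η • if h : IsGam σ η then x ⟨η, h⟩ else 0) hs)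
  rw [map_smul, pairingL_apply, pairing_eStar, dif_pos η.2]
  rfl

/-- The functionals `d_γ^*` separate the points of `ℓ_∞(Γ)`. -/
theorem eq_zero_of_pairing_dStarGam {x : LInf (Gamma σ)}
    (h : ∀ γ, pairing x (dStarGam σ γ) = 0) : x = 0 := by
  have key : ∀ γ : Univ k, ∀ hγ : IsGam σ γ, evalU x (Finsupp.single γ 1) = 0 := by
    refine rank_induction fun γ ih hγ => ?_
    have h1 := h ⟨γ, hγ⟩
    have h2 : evalU x (cStar γ) = 0 :=
      linearMap_congr_support (A := evalU x) (B := 0) fun δ hδ =>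
        ih δ (rank_lt_of_mem_support_cStar hδ)
          (mem_gamSupported.1 (cStar_mem_gamSupported hγ) δ hδ)
    rwa [pairing_dStarGam, dStar, map_sub, h2, sub_zero] at h1
  ext γ
  rw [← evalU_single, key γ.1 γ.2]
  rfl

/-- The vector `d_γ` of `ℓ_∞(Γ)`: its coordinate at `θ` is the coefficient of `d_γ^*` in the
expansion of `e_θ^*`.  This is also the coordinate at `γ` of `P^*_{(0, rank γ]} e_θ^*`, because
the other `d_δ^*` with `rank δ ≤ rank γ` have coordinate `0` at `γ`. -/
def dVec (hmn : Growth m n) (γ : Gamma σ) : LInf (Gamma σ) :=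
  ⟨fun θ => projU (rank γ.1) (Finsupp.single θ.1 1) γ.1, memℓp_infty ⟨2, by
    rintro _ ⟨θ, rfl⟩
    exact (abs_apply_le_sumAbs _ _).trans (sumAbs_projU_single_le hmn θ.2.isMax _)⟩⟩

theorem dVec_apply (hmn : Growth m n) (γ θ : Gamma σ) :
    dVec hmn γ θ = projU (rank γ.1) (Finsupp.single θ.1 1) γ.1 := rfl

theorem evalU_dVec (hmn : Growth m n) (γ : Gamma σ) {b : Univ k →₀ ℝ}
    (hb : b ∈ gamSupported σ) : evalU (dVec hmn γ) b = projU (rank γ.1) b γ.1 :=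
  linearMap_congr_support (A := evalU (dVec hmn γ))
    (B := Finsupp.lapply γ.1 ∘ₗ projU (rank γ.1)) fun θ hθ =>
      evalU_single (dVec hmn γ) ⟨θ, mem_gamSupported.1 hb θ hθ⟩

open Classical in
theorem pairing_dVec_dStarGam (hmn : Growth m n) (γ θ : Gamma σ) :
    pairing (dVec hmn γ) (dStarGam σ θ) = if θ = γ then 1 else 0 := by
  rw [pairing_dStarGam, evalU_dVec hmn γ (dStar_mem_gamSupported θ.2), projU_rank_dStar_apply,
    Finsupp.single_apply]
  simp only [Subtype.ext_iff]

theorem dVec_mem_xSubmodule (hmn : Growth m n) (γ : Gamma σ) : dVec hmn γ ∈ xSubmodule σ :=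
  Submodule.le_topologicalClosure _ (Submodule.subset_span
    ⟨γ, by simp [pairing_dVec_dStarGam], fun θ hθ => by simp [pairing_dVec_dStarGam, hθ]⟩)

end Biorthogonal

/-! ### The operators on `ℓ_1(Γ)` and `𝔛_k` -/

section Operators

variable {k : ℕ} {m n N : ℕ → ℕ} {σ : GammaMax k m n N → ℕ}

/-- The restriction of the coding map to `Γ`. -/
def codeGam (hk : 0 < k) (hσ : IsSigma σ) (γ : Gamma σ) : Option (Gamma σ) :=
  (code γ.1).pmap Subtype.mk fun _ hδ => γ.2.code hk hσ hδ

theorem map_val_codeGam (hk : 0 < k) (hσ : IsSigma σ) (γ : Gamma σ) :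
    (codeGam hk hσ γ).map Subtype.val = code γ.1 := by
  rw [codeGam, Option.map_pmap]
  simp

theorem map_val_codeMax (γ : GammaMax k m n N) :
    (codeMax γ).map Subtype.val = code γ.1 := by
  rw [codeMax, Option.map_pmap]
  simp

theorem map_incl_codeGam (hk : 0 < k) (hσ : IsSigma σ) (γ : Gamma σ) :
    (codeGam hk hσ γ).map (incl σ) = codeMax (incl σ γ) := by
  refine Option.map_injective Subtype.val_injective ?_
  rw [map_val_codeMax, Option.map_map]
  exact map_val_codeGam hk hσ γ

variable {F : Gamma σ → Option (Gamma σ)}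

theorem inclL1_push (hF : ∀ γ, (F γ).map (incl σ) = codeMax (incl σ γ)) (y : L1 (Gamma σ)) :
    inclL1 σ (push F y) = rStar k m n N (inclL1 σ y) := by
  have h : (inclL1 σ).comp (push F) = (rStar k m n N).comp (inclL1 σ) :=
    continuousLinearMap_ext_eStar fun γ => by
      have e : ∀ γ, inclL1 σ (eStar γ) = eStar (incl σ γ) := fun γ => push_eStar _ γ
      rw [ContinuousLinearMap.comp_apply, ContinuousLinearMap.comp_apply, e, push_eStar, rStar,
        push_eStar, image, image, ← hF γ]
      cases F γ with
      | none => exact map_zero _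
      | some δ => exact e δ
  exact congrArg (fun A : L1 (Gamma σ) →L[ℝ] L1 (GammaMax k m n N) => A y) h

/-- The coordinates of `S x` with respect to the `d_θ^*`: as `R^* d_θ^* = d_{G(θ)}^*`, they are
obtained from those of `x` in the same way as the values of `S x` from those of `x`. -/
theorem pairing_pull_dStarGam (hF : ∀ γ, (F γ).map Subtype.val = code γ.1)
    (x : LInf (Gamma σ)) (θ : Gamma σ) :
    pairing (pull F x) (dStarGam σ θ) = (F θ).elim 0 fun δ => pairing x (dStarGam σ δ) := by
  have h : evalU (pull F x) (dStar θ.1) = evalU x (pushFin code (dStar θ.1)) :=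
    linearMap_congr_support (A := evalU (pull F x)) (B := evalU x ∘ₗ pushFin code) fun η hη => by
      have hη' := mem_gamSupported.1 (dStar_mem_gamSupported θ.2) η hη
      have e := evalU_single (pull F x) ⟨η, hη'⟩
      rw [pull_apply] at e
      rw [e, LinearMap.comp_apply, pushFin_single, ← hF ⟨η, hη'⟩]
      cases F ⟨η, hη'⟩ with
      | none => exact (map_zero _).symm
      | some δ => exact (evalU_single x δ).symm
  rw [pairing_dStarGam, h, pushFin_code_dStar, ← hF θ]
  cases F θ with
  | none => exact map_zero _
  | some δ => exact (pairing_dStarGam x δ).symm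

theorem finite_preimage (hF : ∀ γ, (F γ).map Subtype.val = code γ.1) (δ : Gamma σ) :
    {γ | F γ = some δ}.Finite := by
  refine Set.Finite.of_finite_image (f := Subtype.val) ?_ Subtype.val_injective.injOn
  refine (finite_isMax_rank (k := k) (m := m) (n := n) (N := N) (rank δ.1)).subset ?_
  rintro _ ⟨γ, hγ, rfl⟩
  refine ⟨γ.2.isMax, (rank_code ?_).symm⟩
  rw [← hF γ, show F γ = some δ from hγ]
  rfl

/-- The dual operator of `S^*` maps `𝔛_k` into itself: it maps `d_δ` to the sum of the `d_γ` over
the finitely many `γ` with `F(γ) = δ`. -/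
theorem pull_mem_xSubmodule (hmn : Growth m n) (hF : ∀ γ, (F γ).map Subtype.val = code γ.1)
    {x : LInf (Gamma σ)} (hx : x ∈ xSubmodule σ) : pull F x ∈ xSubmodule σ := by
  classical
  suffices h : xSubmodule σ ≤ (xSubmodule σ).comap (pull F : LInf (Gamma σ) →ₗ[ℝ] _) from h hx
  refine Submodule.topologicalClosure_minimal _ (Submodule.span_le.2 ?_)
    ((Submodule.isClosed_topologicalClosure _).preimage (pull F).continuous)
  rintro x ⟨δ, h1, h0⟩
  change pull F x ∈ xSubmodule σ
  have e : pull F x = ∑ γ ∈ (finite_preimage hF δ).toFinset, dVec hmn γ := by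
    refine sub_eq_zero.1 (eq_zero_of_pairing_dStarGam fun θ => ?_)
    rw [← pairingLeft_apply, map_sub, map_sum]
    simp only [pairingLeft_apply, pairing_dVec_dStarGam, pairing_pull_dStarGam hF]
    rw [Finset.sum_ite_eq]
    simp only [Set.Finite.mem_toFinset, Set.mem_ofPred_eq]
    rcases F θ with _ | δ'
    · simp
    · by_cases hδ : δ' = δ
      · subst hδ
        simp [h1]
      · simp [h0 δ' hδ, hδ]
  rw [e]
  exact Submodule.sum_mem _ fun γ _ => dVec_mem_xSubmodule hmn γ

/-- The operator `S` on `𝔛_k`. -/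
def opS (hmn : Growth m n) (hF : ∀ γ, (F γ).map Subtype.val = code γ.1) :
    XSpace σ →L[ℝ] XSpace σ :=
  ((pull F).comp (xSubmodule σ).subtypeL).codRestrict (xSubmodule σ) fun x =>
    pull_mem_xSubmodule hmn hF x.2

theorem toLInf_opS (hmn : Growth m n) (hF : ∀ γ, (F γ).map Subtype.val = code γ.1)
    (x : XSpace σ) : (opS hmn hF x).toLInf = pull F x.toLInf := rfl

theorem norm_opS_le (hmn : Growth m n) (hF : ∀ γ, (F γ).map Subtype.val = code γ.1) :
    ‖opS hmn hF‖ ≤ 1 :=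
  ContinuousLinearMap.opNorm_le_bound _ zero_le_one fun x =>
    (norm_pull_le F x.toLInf).trans_eq (one_mul _).symm

theorem toLInf_opS_pow_apply (hmn : Growth m n) (hF : ∀ γ, (F γ).map Subtype.val = code γ.1)
    (j : ℕ) (x : XSpace σ) (γ : Gamma σ) :
    ((opS hmn hF ^ j) x).toLInf γ = (iterBind F j (some γ)).elim 0 x.toLInf := by
  have h : ∀ j, ((opS hmn hF ^ j) x).toLInf = (pull F ^ j) x.toLInf := by
    intro j
    induction j with
    | zero => rfl
    | succ j ih =>
      rw [pow_succ', pow_succ', mul_apply_eq_comp, mul_apply_eq_comp, toLInf_opS, ih]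
  rw [h, pull_pow_apply]

theorem map_val_iterBind (hF : ∀ γ, (F γ).map Subtype.val = code γ.1) (j : ℕ) (γ : Gamma σ) :
    (iterBind F j (some γ)).map Subtype.val = iterBind code j (some γ.1) :=
  (iterBind_map (f := Subtype.val) (fun γ => (hF γ).symm) j (some γ)).symm

variable (σ) in
/-- The point `i` of the initial set `Δ_1 = {0, …, k - 1}`. -/
def basePoint (i : Fin k) : Gamma σ := ⟨⟨0, Tup.base i⟩, .base i⟩

theorem iterBind_code_base (j i : ℕ) (h : i + j < k) :
    iterBind code j (some (⟨0, Tup.base ⟨i + j, h⟩⟩ : Univ k))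
      = some ⟨0, Tup.base ⟨i, by omega⟩⟩ := by
  induction j with
  | zero => rfl
  | succ j ih =>
    have e : code (⟨0, Tup.base ⟨i + (j + 1), h⟩⟩ : Univ k)
        = some ⟨0, Tup.base ⟨i + j, by omega⟩⟩ := code_eq_some (by simp [codeStep])
    rw [iterBind_succ']
    exact (congrArg (iterBind code j) e).trans (ih (by omega))

theorem iterBind_basePoint (hF : ∀ γ, (F γ).map Subtype.val = code γ.1) {j : ℕ} (hj : j < k) :
    iterBind F j (some (basePoint σ ⟨j, hj⟩)) = some (basePoint σ ⟨0, by omega⟩) := by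
  refine Option.map_injective Subtype.val_injective ?_
  rw [map_val_iterBind hF]
  have h := iterBind_code_base (k := k) j 0 (by omega)
  simp only [zero_add] at h
  exact h

/-- `S^j d_0` takes the value `1` at the point `j` of `Δ_1`. -/
theorem opS_pow_ne_zero (hmn : Growth m n) (hF : ∀ γ, (F γ).map Subtype.val = code γ.1)
    {j : ℕ} (hj : j < k) : opS hmn hF ^ j ≠ 0 := by
  intro h
  let o : Gamma σ := basePoint σ ⟨0, by omega⟩
  let x : XSpace σ := (⟨dVec hmn o, dVec_mem_xSubmodule hmn o⟩ : xSubmodule σ)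
  have h1 := toLInf_opS_pow_apply hmn hF j x (basePoint σ ⟨j, hj⟩)
  rw [iterBind_basePoint hF hj, h] at h1
  have h2 : dVec hmn o o = 1 := by
    rw [dVec_apply, projU_single_of_le le_rfl, Finsupp.single_eq_same]
  exact zero_ne_one (h1.trans h2)

theorem opS_pow_eq_zero (hk : 0 < k) (hmn : Growth m n)
    (hF : ∀ γ, (F γ).map Subtype.val = code γ.1) : opS hmn hF ^ k = 0 := by
  ext x
  refine Subtype.ext (lp.ext (funext fun γ => ?_))
  have h := toLInf_opS_pow_apply hmn hF k x γ
  have e := map_val_iterBind hF k γ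
  rw [iterBind_code_eq_none hk, Option.map_eq_none_iff] at e
  rw [e] at h
  exact h

theorem norm_push_eq_one (hk : 2 ≤ k) (hF : ∀ γ, (F γ).map Subtype.val = code γ.1) :
    ‖push F‖ = 1 := by
  refine le_antisymm (norm_push_le F) ?_
  have h := (push F).le_opNorm (eStar (basePoint σ ⟨1, hk⟩))
  have e : F (basePoint σ ⟨1, hk⟩) = some (basePoint σ ⟨0, by omega⟩) :=
    iterBind_basePoint hF hk
  rwa [push_eStar, image, e, norm_eStar, norm_eStar, mul_one] at h

end Operators

end BourgainDelbaen

end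

open BourgainDelbaen in
theorem proposition2p17 (k : ℕ) (hk : 2 ≤ k) (m n N : ℕ → ℕ) (hmn : Growth m n)
    (hN : StrictMono N) (σ : GammaMax k m n N → ℕ) (hσ : IsSigma σ) :
    (∀ γ : Gamma σ, ∀ δ : GammaMax k m n N, codeMax (incl σ γ) = some δ → IsGam σ δ.1) ∧
    ∃ F : Gamma σ → Option (Gamma σ),
      (∀ γ, (F γ).map (incl σ) = codeMax (incl σ γ)) ∧
      ∃ Sstar : L1 (Gamma σ) →L[ℝ] L1 (Gamma σ),
        (∀ y, inclL1 σ (Sstar y) = rStar k m n N (inclL1 σ y)) ∧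
        ‖Sstar‖ = 1 ∧
        (∀ γ, F γ = none → Sstar (eStar γ) = 0) ∧
        (∀ γ δ, F γ = some δ → Sstar (eStar γ) = eStar δ) ∧
        ∃ S : XSpace σ →L[ℝ] XSpace σ,
          (∀ (x : XSpace σ) (y : L1 (Gamma σ)),
            pairing (S x).toLInf y = pairing x.toLInf (Sstar y)) ∧
          ‖S‖ ≤ 1 ∧
          (∀ j : ℕ, 1 ≤ j → j ≤ k - 1 → S ^ j ≠ 0) ∧
          S ^ k = 0 := by
  have hk0 : 0 < k := by omega
  have hF := map_val_codeGam hk0 hσ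
  refine ⟨fun γ δ hδ => ?_, codeGam hk0 hσ, map_incl_codeGam hk0 hσ, push (codeGam hk0 hσ),
    inclL1_push (map_incl_codeGam hk0 hσ), norm_push_eq_one hk hF, fun γ h => ?_,
    fun γ δ h => ?_, opS hmn hF, fun x y => pairing_pull _ x.toLInf y, norm_opS_le hmn hF,
    fun j _ hj => opS_pow_ne_zero hmn hF (by omega), opS_pow_eq_zero hk0 hmn hF⟩
  · refine γ.2.code hk0 hσ ?_
    rw [← show (incl σ γ).1 = γ.1 from rfl, ← map_val_codeMax, hδ]
    rfl
  · rw [push_eStar, image, h]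
  · rw [push_eStar, image, h]
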